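/- Let $G$ be a locally compact (Hausdorff) group with left Haar measure $m_G$, and let $M(G)$ be the space of bounded regular complex Borel measures on $G$, with the total variation norm $\|\cdot\|$. The vague topology on $M(G)$ is $\sigma(M(G),C_0(G))$. The convolution of $\mu,\nu\in M(G)$ is the measure $\mu*\nu\in M(G)$ with $\int f\,d(\mu*\nu)=\iint f(xy)\,d\mu(x)\,d\nu(y)$ for every continuous compactly supported $f\colon G\to\mathbb{C}$; $\mu^n$ is the $n$-th convolution power of $\mu$ and $\mu_{[n]}=\frac1n(\mu+\mu^2+\cdots+\mu^n)$. The measure $\mu$ is *vague-ergodic* if $(\mu_{[n]})_n$ converges vaguely to some measure in $M(G)$, and *Cesàro bounded* if $\sup_n\|\mu_{[n]}\|<\infty$. For $1\le p<\infty$, $\lambda_p(\mu)$ is the bounded operator on $L^p(G)=L^p(G,m_G)$ (complex-valued functions) given by $(\lambda_p(\mu)f)(s)=\int f(x^{-1}s)\,d\mu(x)$ for almost every $s\in G$. A bounded operator $T$ on a Banach space $X$ is *mean ergodic* (respectively *weakly mean ergodic*) if $T_{[n]}=\frac1n(T+T^2+\cdots+T^n)$ converges to some bounded operator $P$ on $X$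 in the strong (respectively weak) operator topology. Finally, $H_\mu$ is the closed subgroup of $G$ generated by the support of $\mu$. **Proposition.** Let $G$ be a locally compact group and let $\mu\in M(G)$. The following statements are equivalent: 1. $\mu$ is vague-ergodic. 2. $\mu$ is Cesàro bounded and $\lim_n \frac{\mu^n}{n}=0$ vaguely. 3. $\mu$ is Cesàro bounded and $\lambda_p(\mu)$ is weakly mean ergodic for all $1<p<\infty$. 4. $\mu$ is Cesàro bounded and $\lambda_p(\mu)$ is weakly mean ergodic for some $1<p<\infty$. If $H_\mu$ is compact, then (1) and (2) are also equivalent to each of the following two statements: - (3$'$) $\mu$ is Cesàro bounded and $\lambda_p(\mu)$ is mean ergodic for all $1\le p<\infty$. - (4$'$) $\mu$ is Cesàro bounded and $\lambda_p(\mu)$ is mean ergodic for some $1\le p<\infty$. -/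

import Mathlib

open MeasureTheory Filter Topology
open scoped ENNReal NNReal ZeroAtInfty


namespace VagueErgodic

theorem isFiniteMeasure_variation {X : Type*} [MeasurableSpace X] (μ : ComplexMeasure X) :
    IsFiniteMeasure μ.variation := by
  set r := ComplexMeasure.re μ with hr
  set i := ComplexMeasure.im μ with hi
  have : μ.variation ≤ r.totalVariation + i.totalVariation := by
    apply VectorMeasure.variation_le_of_forall_enorm_le
    intro E hE
    have h1 : ‖μ E‖ₑ ≤ ‖r E‖ₑ + ‖i E‖ₑ := by
      have := Complex.norm_le_abs_re_add_abs_im (μ E)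
      rw [← ofReal_norm, ← ofReal_norm, ← ofReal_norm, ← ENNReal.ofReal_add (norm_nonneg _) (norm_nonneg _)]
      exact ENNReal.ofReal_le_ofReal this
    refine h1.trans ?_
    rw [Measure.add_apply]
    exact add_le_add (SignedMeasure.enorm_le_totalVariation _ _) (SignedMeasure.enorm_le_totalVariation _ _)
  exact isFiniteMeasure_of_le _ this

theorem regular_of_le {X : Type*} [TopologicalSpace X] [T2Space X] [MeasurableSpace X] [BorelSpace X]
    {ρ v : Measure X} [IsFiniteMeasure v] [v.Regular] (h : ρ ≤ v) : ρ.Regular := by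
  have : IsFiniteMeasure ρ := isFiniteMeasure_of_le v h
  have : ρ.InnerRegularCompactLTTop := by
    refine ⟨fun A hA r hr => ?_⟩
    obtain ⟨hAm, -⟩ := hA
    have hpos : ρ A - r ≠ 0 := (tsub_pos_of_lt hr).ne'
    obtain ⟨K, hKA, hK, hlt⟩ := hAm.exists_isCompact_sdiff_lt (measure_ne_top v A) hpos
    refine ⟨K, hKA, hK, ?_⟩
    have h1 : ρ A = ρ K + ρ (A \ K) := by
      rw [← measure_union disjoint_sdiff_self_right (hAm.diff hK.measurableSet),
        Set.union_sdiff_cancel hKA]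
    have h2 : ρ (A \ K) < ρ A - r := (h _).trans_lt hlt
    by_contra hcon
    push Not at hcon
    have : ρ A < r + (ρ A - r) := by
      rw [h1] at h2 ⊢
      exact ENNReal.add_lt_add_of_le_of_lt (measure_ne_top _ _) hcon h2
    rw [add_tsub_cancel_of_le hr.le] at this
    exact lt_irrefl _ this
  infer_instance

/-- `M(G)`: the vector space of (bounded) regular complex Borel measures on `G`, that is, of the
complex measures whose total variation is a regular measure. The total variation of a complex
measure is automatically finite, see `isFiniteMeasure_variation`. -/
def M (G : Type*) [TopologicalSpace G] [T2Space G] [MeasurableSpace G] [BorelSpace G] :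
    Submodule ℂ (ComplexMeasure G) where
  carrier := {μ | μ.variation.Regular}
  zero_mem' := by
    simp only [Set.mem_ofPred_eq, VectorMeasure.variation_zero]; infer_instance
  add_mem' := by
    intro μ ν hμ hν
    simp only [Set.mem_ofPred_eq] at *
    have := isFiniteMeasure_variation μ
    have := isFiniteMeasure_variation ν
    have : (μ.variation + ν.variation).Regular := by
      have : (μ.variation + ν.variation).InnerRegular := inferInstance
      infer_instance
    exact regular_of_le (VectorMeasure.variation_add_le (μ := μ) (ν := ν))
  smul_mem' := by
    intro c μ hμ
    simp only [Set.mem_ofPred_eq] at *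
    rw [VectorMeasure.variation_smul]
    exact Measure.Regular.smul enorm_ne_top

/-- The integral `∫ f dμ` of a complex function against a complex measure. -/
noncomputable def cint {X : Type*} [MeasurableSpace X] (μ : ComplexMeasure X) (f : X → ℂ) : ℂ :=
  VectorMeasure.integral μ f (ContinuousLinearMap.mul ℝ ℂ)

/-- The integral against a linear combination of finite positive measures. -/
theorem cint_eq_sum {X ι : Type*} [MeasurableSpace X] [Fintype ι] (κ : ComplexMeasure X)
    (a : ι → ℂ) (ρ : ι → Measure X) [∀ k, IsFiniteMeasure (ρ k)]
    (h : ∀ s, MeasurableSet s → κ s = ∑ k, a k * ((ρ k).real s : ℂ))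
    {f : X → ℂ} (hf : ∀ k, Integrable f (ρ k)) :
    cint κ f = ∑ k, a k * ∫ x, f x ∂(ρ k) := by
  have := isFiniteMeasure_variation κ
  set C : ℝ≥0 := ∑ k, ‖a k‖₊ with hC
  set Q : Measure X := ∑ k, ρ k with hQ
  have hle : κ.variation ≤ (C : ℝ≥0∞) • Q := by
    apply VectorMeasure.variation_le_of_forall_enorm_le
    intro E hE
    rw [h E hE, Measure.smul_apply, hQ, Measure.finsetSum_apply, smul_eq_mul, Finset.mul_sum]
    refine (enorm_sum_le _ _).trans (Finset.sum_le_sum fun k _ => ?_)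
    rw [enorm_mul]
    gcongr
    · exact_mod_cast Finset.single_le_sum (f := fun k => ‖a k‖₊) (fun _ _ => zero_le) (Finset.mem_univ k)
    · rw [← ofReal_norm, Complex.norm_real, Real.norm_of_nonneg measureReal_nonneg]
      exact (ENNReal.ofReal_toReal (measure_ne_top _ _)).le
  have hk (k : ι) : ρ k ≤ Q := by
    intro s
    rw [hQ, Measure.finsetSum_apply]
    exact Finset.single_le_sum (f := fun k => ρ k s) (fun _ _ => zero_le) (Finset.mem_univ k)
  have hRf : Integrable f Q := integrable_finsetSum_measure.2 fun k _ => hf k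
  have hfin : IsFiniteMeasure Q := by rw [hQ]; infer_instance
  revert hRf
  have toV {g : X → ℂ} (hg : Integrable g Q) : κ.Integrable g :=
    (hg.smul_measure ENNReal.coe_ne_top).mono_measure hle
  clear hf
  apply Integrable.induction (P := fun f => cint κ f = ∑ k, a k * ∫ x, f x ∂(ρ k))
  · intro c s hs hfs
    rw [cint, VectorMeasure.integral, setToFun_indicator_const _ hs (measure_ne_top _ _)]
    have : (κ.transpose (ContinuousLinearMap.mul ℝ ℂ)) s c = c * κ s := rfl
    rw [this, h s hs, Finset.mul_sum]
    refine Finset.sum_congr rfl fun k _ => ?_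
    rw [integral_indicator_const _ hs]
    simp; ring
  · intro f g _ hf hg h1 h2
    rw [cint, VectorMeasure.integral_add (toV hf) (toV hg), ← cint, ← cint, h1, h2, ← Finset.sum_add_distrib]
    refine Finset.sum_congr rfl fun k _ => ?_
    rw [integral_add' (hf.mono_measure (hk k)) (hg.mono_measure (hk k)), mul_add]
  · apply isClosed_eq
    · refine continuous_iff_continuousAt.2 fun f => ?_
      have hC : Tendsto (fun g : X →₁[Q] ℂ => (C : ℝ) * ‖g - f‖) (𝓝 f) (𝓝 0) := by
        have : Continuous (fun g : X →₁[Q] ℂ => (C : ℝ) * ‖g - f‖) := by fun_prop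
        simpa using this.tendsto f
      refine tendsto_iff_norm_sub_tendsto_zero.2 (squeeze_zero (fun _ => norm_nonneg _) (fun g => ?_) hC)
      have hgi := toV (L1.integrable_coeFn g)
      have hfi := toV (L1.integrable_coeFn f)
      simp only [cint]
      rw [← VectorMeasure.integral_fun_sub hgi hfi]
      refine (VectorMeasure.norm_integral_le_integral_norm).trans ?_
      have hB : ‖ContinuousLinearMap.mul ℝ ℂ‖ ≤ 1 := ContinuousLinearMap.opNorm_mul_le ℝ ℂ
      have hint : Integrable (fun x => ‖g x - f x‖) Q := ((L1.integrable_coeFn g).sub (L1.integrable_coeFn f)).norm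
      have h2 : ∫ x, ‖g x - f x‖ ∂κ.variation ≤ C * ‖g - f‖ := by
        calc _ ≤ ∫ x, ‖g x - f x‖ ∂((C : ℝ≥0∞) • Q) :=
              integral_mono_measure hle (ae_of_all _ fun _ => norm_nonneg _)
                (hint.smul_measure ENNReal.coe_ne_top)
          _ = C * ∫ x, ‖g x - f x‖ ∂Q := by rw [integral_smul_measure]; simp
          _ = _ := by
            rw [L1.norm_eq_integral_norm]
            congr 1
            refine integral_congr_ae ?_
            filter_upwards [Lp.coeFn_sub g f] with x hx
            rw [hx]; rfl
      calc _ ≤ 1 * ∫ x, ‖g x - f x‖ ∂κ.variation := by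
            gcongr
            
        _ ≤ _ := by rw [one_mul]; exact h2
    · refine continuous_finsetSum _ fun k _ => continuous_const.mul ?_
      refine continuous_iff_continuousAt.2 fun f => ?_
      have hC : Tendsto (fun g : X →₁[Q] ℂ => ‖g - f‖) (𝓝 f) (𝓝 0) := by
        have : Continuous (fun g : X →₁[Q] ℂ => ‖g - f‖) := by fun_prop
        simpa using this.tendsto f
      refine tendsto_iff_norm_sub_tendsto_zero.2 (squeeze_zero (fun _ => norm_nonneg _) (fun g => ?_) hC)
      have hgi := (L1.integrable_coeFn g).mono_measure (hk k)
      have hfi := (L1.integrable_coeFn f).mono_measure (hk k)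
      have hint : Integrable (fun x => ‖g x - f x‖) Q := ((L1.integrable_coeFn g).sub (L1.integrable_coeFn f)).norm
      rw [← integral_sub hgi hfi]
      refine (norm_integral_le_integral_norm _).trans ?_
      calc _ ≤ (∫ x, ‖g x - f x‖ ∂Q) :=
              integral_mono_measure (hk k) (ae_of_all _ fun _ => norm_nonneg _) hint
          _ = _ := by
            rw [L1.norm_eq_integral_norm]
            refine integral_congr_ae ?_
            filter_upwards [Lp.coeFn_sub g f] with x hx
            rw [hx]; rfl
  · intro f g hfg hf h1
    have : f =ᵐ[κ.variation] g := by
      refine (Measure.absolutelyContinuous_of_le hle).ae_eq ?_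
      exact Measure.ae_smul_measure hfg _
    rw [cint, ← VectorMeasure.integral_congr_ae this, ← cint, h1]
    refine Finset.sum_congr rfl fun k _ => ?_
    rw [integral_congr_ae ((Measure.absolutelyContinuous_of_le (hk k)).ae_eq hfg)]
set_option linter.unusedSectionVars false

theorem unif_left {G E : Type*} [Group G] [TopologicalSpace G] [IsTopologicalGroup G]
    [NormedAddCommGroup E] {f : G → E} (hf : Continuous f) (hc : HasCompactSupport f)
    (x₀ : G) {ε : ℝ} (hε : 0 < ε) :
    ∀ᶠ x in 𝓝 x₀, ∀ s, ‖f (x⁻¹ * s) - f (x₀⁻¹ * s)‖ < ε := by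
  let _ : UniformSpace G := IsTopologicalGroup.rightUniformSpace G
  have hu : UniformContinuous f := hc.uniformContinuous_of_continuous hf
  have h1 := hu (Metric.dist_mem_uniformity hε)
  rw [mem_map, uniformity_eq_comap_nhds_one' G, mem_comap] at h1
  obtain ⟨V, hV, hVs⟩ := h1
  have h2 : Tendsto (fun x : G => x₀⁻¹ * x) (𝓝 x₀) (𝓝 1) := by
    have : Continuous (fun x : G => x₀⁻¹ * x) := by fun_prop
    simpa using this.tendsto x₀
  filter_upwards [h2 hV] with x hx s
  have : ((x⁻¹ * s, x₀⁻¹ * s) : G × G) ∈ (fun p : G × G => p.2 * p.1⁻¹) ⁻¹' V := by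
    simpa [mul_assoc] using hx
  have := hVs this
  simpa [dist_eq_norm] using this

theorem unif_right {G E : Type*} [Group G] [TopologicalSpace G] [IsTopologicalGroup G]
    [NormedAddCommGroup E] {f : G → E} (hf : Continuous f) (hc : HasCompactSupport f)
    (y₀ : G) {ε : ℝ} (hε : 0 < ε) :
    ∀ᶠ y in 𝓝 y₀, ∀ x, ‖f (x * y) - f (x * y₀)‖ < ε := by
  have h1 := unif_left (f := fun u => f u⁻¹) (hf.comp continuous_inv)
    (hc.comp_homeomorph (Homeomorph.inv G)) y₀ hε
  filter_upwards [h1] with y hy x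
  simpa using hy x⁻¹

variable {G : Type*} [Group G] [TopologicalSpace G] [IsTopologicalGroup G] [LocallyCompactSpace G]
  [T2Space G] [MeasurableSpace G] [BorelSpace G]

theorem integrable_of_cc {E : Type*} [NormedAddCommGroup E]
    {f : G → E} (hf : Continuous f) (hc : HasCompactSupport f) (v : Measure G) [IsFiniteMeasure v] :
    Integrable f v := hf.integrable_of_hasCompactSupport hc

theorem integrable_translate {E : Type*} [NormedAddCommGroup E]
    {f : G → E} (hf : Continuous f) (hc : HasCompactSupport f) (v : Measure G) [IsFiniteMeasure v]
    (y : G) : Integrable (fun x => f (x * y)) v :=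
  integrable_of_cc (hf.comp (continuous_mul_const y)) (hc.comp_homeomorph (Homeomorph.mulRight y)) v

theorem continuous_inner {E : Type*} [NormedAddCommGroup E] [NormedSpace ℝ E]
    {f : G → E} (hf : Continuous f) (hc : HasCompactSupport f) (v : Measure G) [IsFiniteMeasure v] :
    Continuous fun y => ∫ x, f (x * y) ∂v := by
  refine continuous_iff_continuousAt.2 fun y₀ => Metric.tendsto_nhds.2 fun ε hε => ?_
  have hd : 0 < ε / (v.real Set.univ + 1) := by positivity
  filter_upwards [unif_right hf hc y₀ hd] with y hy
  rw [dist_eq_norm, ← integral_sub (integrable_translate hf hc v y) (integrable_translate hf hc v y₀)]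
  refine (norm_integral_le_of_norm_le_const (ae_of_all _ fun x => (hy x).le)).trans_lt ?_
  have : (0:ℝ) ≤ v.real Set.univ := measureReal_nonneg
  rw [div_mul_eq_mul_div, div_lt_iff₀ (by positivity)]
  nlinarith

theorem integrable_inner {E : Type*} [NormedAddCommGroup E] [NormedSpace ℝ E]
    [SecondCountableTopologyEither G E]
    {f : G → E} (hf : Continuous f) (hc : HasCompactSupport f) (v w : Measure G) [IsFiniteMeasure v]
    [IsFiniteMeasure w] : Integrable (fun y => ∫ x, f (x * y) ∂v) w := by
  obtain ⟨C, hC⟩ := hf.bounded_above_of_compact_support hc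
  refine Integrable.of_bound (continuous_inner hf hc v).aestronglyMeasurable (C * v.real Set.univ)
    (ae_of_all _ fun y => norm_integral_le_of_norm_le_const (ae_of_all _ fun x => hC _))

open CompactlySupported in
theorem exists_conv_pos (v w : Measure G) [IsFiniteMeasure v] [IsFiniteMeasure w] :
    ∃ r : Measure G, IsFiniteMeasure r ∧ r.Regular ∧ ∀ f : G → ℂ, Continuous f →
      HasCompactSupport f → ∫ z, f z ∂r = ∫ y, ∫ x, f (x * y) ∂v ∂w := by
  let Λ : C_c(G, ℝ) →ₚ[ℝ] ℝ := PositiveLinearMap.mk₀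
    { toFun := fun f => ∫ y, ∫ x, f (x * y) ∂v ∂w
      map_add' := by
        intro f g
        rw [← integral_add (integrable_inner (map_continuous f) f.hasCompactSupport v w)
          (integrable_inner (map_continuous g) g.hasCompactSupport v w)]
        congr 1 with y
        rw [← integral_add (integrable_translate (map_continuous f) f.hasCompactSupport v y)
          (integrable_translate (map_continuous g) g.hasCompactSupport v y)]
        rfl
      map_smul' := by
        intro c f
        simp [integral_const_mul] }
    (fun f hf => integral_nonneg fun y => integral_nonneg fun x => hf _)
  have hΛ (f : C_c(G, ℝ)) : Λ f = ∫ y, ∫ x, f (x * y) ∂v ∂w := rfl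
  have key (f : G → ℝ) (hf : Continuous f) (hc : HasCompactSupport f) :
      ∫ z, f z ∂(RealRMK.rieszMeasure Λ) = ∫ y, ∫ x, f (x * y) ∂v ∂w :=
    RealRMK.integral_rieszMeasure Λ ⟨⟨f, hf⟩, hc⟩
  refine ⟨RealRMK.rieszMeasure Λ, ⟨?_⟩, inferInstance, ?_⟩
  · rw [isOpen_univ.measure_eq_iSup_isCompact]
    refine (iSup₂_le fun K _ => iSup_le fun hK => ?_ : _ ≤ ENNReal.ofReal (v.real Set.univ * w.real Set.univ)).trans_lt
      ENNReal.ofReal_lt_top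
    obtain ⟨φ, h1, h2, -, h3⟩ := exists_continuousMap_one_of_isCompact_subset_isOpen hK isOpen_univ
      (Set.subset_univ K)
    refine (RealRMK.rieszMeasure_le_of_eq_one Λ (f := ⟨φ, h2⟩) (fun x => (h3 x).1) hK
      (fun x hx => h1 hx)).trans ?_
    apply ENNReal.ofReal_le_ofReal
    rw [hΛ]
    have hi (y : G) : ∫ x, φ (x * y) ∂v ≤ v.real Set.univ := by
      calc _ ≤ ∫ x, (1 : ℝ) ∂v := integral_mono (integrable_translate φ.continuous h2 v y)
            (integrable_const _) (fun x => (h3 _).2)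
        _ = _ := by simp
    calc _ ≤ ∫ y, v.real Set.univ ∂w := integral_mono (integrable_inner φ.continuous h2 v w)
            (integrable_const _) hi
      _ = _ := by simp [mul_comm]
  · intro f hf hc
    have hre := key (fun z => (f z).re) (Complex.continuous_re.comp hf)
      (hc.comp_left (g := Complex.re) Complex.zero_re)
    have him := key (fun z => (f z).im) (Complex.continuous_im.comp hf)
      (hc.comp_left (g := Complex.im) Complex.zero_im)
    have hfin : IsFiniteMeasureOnCompacts (RealRMK.rieszMeasure Λ) := inferInstance
    have e1 : Integrable f (RealRMK.rieszMeasure Λ) := hf.integrable_of_hasCompactSupport hc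
    apply Complex.ext
    · have a1 := integral_re e1
      have a2 := integral_re (integrable_inner hf hc v w)
      simp only [RCLike.re_to_complex] at a1 a2
      rw [← a1, ← a2, hre]
      congr 1 with y
      exact (integral_re (integrable_translate hf hc v y))
    · have a1 := integral_im e1
      have a2 := integral_im (integrable_inner hf hc v w)
      simp only [RCLike.im_to_complex] at a1 a2
      rw [← a1, ← a2, him]
      congr 1 with y
      exact (integral_im (integrable_translate hf hc v y))

/-- The coefficients in the Jordan decomposition of a complex measure. -/
noncomputable def coef : Fin 4 → ℂ := ![1, -1, Complex.I, -Complex.I]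

theorem exists_decomp (μ : M G) : ∃ ρ : Fin 4 → Measure G, (∀ k, IsFiniteMeasure (ρ k)) ∧
    (∀ k, (ρ k).Regular) ∧ (∀ k, ρ k ≤ μ.1.variation) ∧
    ∀ s, MeasurableSet s → μ.1 s = ∑ k, coef k * ((ρ k).real s : ℂ) := by
  have := isFiniteMeasure_variation μ.1
  have : μ.1.variation.Regular := μ.2
  set r := ComplexMeasure.re μ.1 with hr
  set i := ComplexMeasure.im μ.1 with hi
  have hrle : r.totalVariation ≤ μ.1.variation := by
    rw [SignedMeasure.totalVariation_eq_variation]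
    apply VectorMeasure.variation_le_of_forall_enorm_le
    intro E hE
    refine le_trans ?_ (VectorMeasure.enorm_measure_le_variation _ _)
    rw [← ofReal_norm, ← ofReal_norm]
    exact ENNReal.ofReal_le_ofReal (Complex.abs_re_le_norm _)
  have hile : i.totalVariation ≤ μ.1.variation := by
    rw [SignedMeasure.totalVariation_eq_variation]
    apply VectorMeasure.variation_le_of_forall_enorm_le
    intro E hE
    refine le_trans ?_ (VectorMeasure.enorm_measure_le_variation _ _)
    rw [← ofReal_norm, ← ofReal_norm]
    exact ENNReal.ofReal_le_ofReal (Complex.abs_im_le_norm _)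
  let ρ : Fin 4 → Measure G := ![r.toJordanDecomposition.posPart, r.toJordanDecomposition.negPart,
    i.toJordanDecomposition.posPart, i.toJordanDecomposition.negPart]
  have hle : ∀ k, ρ k ≤ μ.1.variation := by
    intro k
    fin_cases k
    · exact (Measure.le_add_right le_rfl).trans hrle
    · exact (Measure.le_add_left le_rfl).trans hrle
    · exact (Measure.le_add_right le_rfl).trans hile
    · exact (Measure.le_add_left le_rfl).trans hile
  refine ⟨ρ, fun k => isFiniteMeasure_of_le _ (hle k), fun k => regular_of_le (hle k), hle, ?_⟩
  intro s hs
  have h1 := r.apply_eq_posPart_real_sub_negPart_real hs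
  have h2 := i.apply_eq_posPart_real_sub_negPart_real hs
  have e1 : r s = (μ.1 s).re := rfl
  have e2 : i s = (μ.1 s).im := rfl
  rw [← Complex.re_add_im (μ.1 s), ← e1, ← e2, h1, h2]
  simp [coef, ρ, Fin.sum_univ_four]
  ring

theorem exists_comb {ι : Type*} [Fintype ι] (a : ι → ℂ) (ρ : ι → Measure G)
    [∀ k, IsFiniteMeasure (ρ k)] [∀ k, (ρ k).Regular] :
    ∃ μ : M G, ∀ s, MeasurableSet s → μ.1 s = ∑ k, a k * ((ρ k).real s : ℂ) := by
  let c (k : ι) : ComplexMeasure G := SignedMeasure.toComplexMeasure (ρ k).toSignedMeasure 0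
  have hc (k : ι) {s : Set G} (hs : MeasurableSet s) : c k s = ((ρ k).real s : ℂ) := by
    simp only [c, SignedMeasure.toComplexMeasure_apply, Measure.toSignedMeasure_apply_measurable hs]
    rfl
  have hle (k : ι) : (c k).variation ≤ ρ k := by
    apply VectorMeasure.variation_le_of_forall_enorm_le
    intro E hE
    rw [hc k hE, ← ofReal_norm, Complex.norm_real, Real.norm_of_nonneg measureReal_nonneg]
    exact (ENNReal.ofReal_toReal (measure_ne_top _ _)).le
  let d (k : ι) : M G := ⟨c k, regular_of_le (hle k)⟩
  refine ⟨∑ k, a k • d k, fun s hs => ?_⟩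
  have : ((∑ k, a k • d k : M G) : ComplexMeasure G) = ∑ k, a k • c k := by
    simp [d]
  rw [this, FunLike.coe_sum]
  simp [Finset.sum_apply, hc _ hs]

/-- Existence of the convolution of two regular complex measures. -/
theorem exists_conv (μ ν : M G) : ∃ κ : M G, ∀ f : G → ℂ, Continuous f → HasCompactSupport f →
    cint κ.1 f = cint ν.1 fun y => cint μ.1 fun x => f (x * y) := by
  obtain ⟨ρ, h1, h2, h3, h4⟩ := exists_decomp μ
  obtain ⟨σ, g1, g2, g3, g4⟩ := exists_decomp ν
  choose r hr1 hr2 hr3 using fun p : Fin 4 × Fin 4 => exists_conv_pos (ρ p.1) (σ p.2)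
  obtain ⟨κ, hκ⟩ := exists_comb (fun p : Fin 4 × Fin 4 => coef p.1 * coef p.2) r
  refine ⟨κ, fun f hf hc => ?_⟩
  rw [cint_eq_sum κ.1 _ r hκ fun p => integrable_of_cc hf hc _]
  have e (y : G) : (cint μ.1 fun x => f (x * y)) = ∑ i, coef i * ∫ x, f (x * y) ∂(ρ i) :=
    cint_eq_sum μ.1 _ ρ h4 fun p => integrable_translate hf hc _ y
  simp_rw [e]
  have hi (i j) : Integrable (fun y => coef i * ∫ x, f (x * y) ∂(ρ i)) (σ j) :=
    (integrable_inner hf hc (ρ i) (σ j)).const_mul _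
  rw [cint_eq_sum ν.1 _ σ g4 fun j => integrable_finsetSum _ fun i _ => hi i j]
  rw [Fintype.sum_prod_type, Finset.sum_comm]
  refine Finset.sum_congr rfl fun j _ => ?_
  rw [integral_finsetSum _ fun i _ => hi i j, Finset.mul_sum]
  refine Finset.sum_congr rfl fun i _ => ?_
  rw [integral_const_mul, hr3 (i, j) f hf hc]
  ring

/-- The convolution `μ * ν`: the (unique) regular complex measure with
`⟨μ * ν, f⟩ = ∫ ∫ f (x y) dμ(x) dν(y)` for all continuous compactly supported `f`. -/
noncomputable def conv (μ ν : M G) : M G := (exists_conv μ ν).choose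

theorem cint_conv (μ ν : M G) {f : G → ℂ} (hf : Continuous f) (hc : HasCompactSupport f) :
    cint (conv μ ν).1 f = cint ν.1 fun y => cint μ.1 fun x => f (x * y) :=
  (exists_conv μ ν).choose_spec f hf hc

/-- Convolution powers, with exponent shifted by one: `convPowSucc μ n` is `μ ^ (n + 1)`. -/
noncomputable def convPowSucc (μ : M G) : ℕ → M G
  | 0 => μ
  | n + 1 => conv (convPowSucc μ n) μ

/-- The averages `(μ + μ ^ 2 + ⋯ + μ ^ n) / n`. -/
noncomputable def cesaro (μ : M G) (n : ℕ) : M G :=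
  (n : ℂ)⁻¹ • ∑ k ∈ Finset.range n, convPowSucc μ k

/-- Convergence of a sequence in the vague topology `σ(M(G), C₀(G))`. -/
def VagueTendsto (ν : ℕ → M G) (κ : M G) : Prop :=
  ∀ f : C₀(G, ℂ), Tendsto (fun n => cint (ν n).1 f) atTop (𝓝 (cint κ.1 f))

/-- `μ` is vague-ergodic if its averages converge vaguely to some measure in `M(G)`. -/
def IsVagueErgodic (μ : M G) : Prop := ∃ κ : M G, VagueTendsto (cesaro μ) κ

/-- `μ` is Cesàro bounded if its averages are bounded in the total variation norm. -/
def CesaroBounded (μ : M G) : Prop :=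
  ∃ C : ℝ≥0, ∀ n : ℕ, (cesaro μ n).1.variation Set.univ ≤ C

/-- `H_μ`: the closed subgroup generated by the support of `μ`. -/
def supportSubgroup (μ : M G) : Subgroup G :=
  (Subgroup.closure μ.1.variation.support).topologicalClosure

theorem exists_sigmaCompact_conull (v : Measure G) [IsFiniteMeasure v] [v.Regular] :
    ∃ K : ℕ → Set G, (∀ n, IsCompact (K n)) ∧ ∀ᵐ x ∂v, x ∈ ⋃ n, K n := by
  have h (n : ℕ) : ∃ K : Set G, IsCompact K ∧ v Kᶜ < ((n : ℝ≥0∞) + 1)⁻¹ := by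
    obtain ⟨K, -, hK, hlt⟩ := MeasurableSet.univ.exists_isCompact_sdiff_lt (measure_ne_top v _)
      (show ((n : ℝ≥0∞) + 1)⁻¹ ≠ 0 by simp)
    exact ⟨K, hK, by rwa [Set.compl_eq_univ_sdiff]⟩
  choose K hK hlt using h
  refine ⟨K, hK, ?_⟩
  rw [ae_iff]
  refine le_antisymm (ENNReal.le_of_forall_pos_le_add fun ε hε _ => ?_) zero_le
  obtain ⟨n, hn⟩ := ENNReal.exists_inv_nat_lt (ENNReal.coe_ne_zero.2 hε.ne')
  have : {a | a ∉ ⋃ n, K n} ⊆ (K n)ᶜ := fun x hx hxn => hx (Set.mem_iUnion.2 ⟨n, hxn⟩)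
  rw [zero_add]
  refine (measure_mono this).trans ((hlt n).le.trans (le_trans ?_ hn.le))
  exact ENNReal.inv_le_inv.2 le_self_add

theorem aesm_of_continuous {E : Type*} [NormedAddCommGroup E] {g : G → E} (hg : Continuous g)
    (v : Measure G) [IsFiniteMeasure v] [v.Regular] : AEStronglyMeasurable g v := by
  obtain ⟨K, hK, hae⟩ := exists_sigmaCompact_conull v
  rw [← Measure.restrict_eq_self_of_ae_mem hae, aestronglyMeasurable_iUnion_iff]
  exact fun n => hg.continuousOn.aestronglyMeasurable_of_isCompact (hK n) (hK n).measurableSet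

open scoped Pointwise

section Young

variable (m : Measure G) [m.IsHaarMeasure] [m.Regular] {p : ℝ≥0∞} [Fact (1 ≤ p)]

/-- Left translation `f ↦ f (x⁻¹ ·)` on `L^p`. -/
noncomputable def translate (x : G) (f : Lp ℂ p m) : Lp ℂ p m := DomMulAct.mk x⁻¹ • f

theorem translate_ae (x : G) (f : Lp ℂ p m) : translate m x f =ᵐ[m] fun s => f (x⁻¹ * s) :=
  DomMulAct.smul_Lp_ae_eq (DomMulAct.mk x⁻¹) f

theorem translate_add (x : G) (f g : Lp ℂ p m) :
    translate m x (f + g) = translate m x f + translate m x g :=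
  DomMulAct.smul_Lp_add (DomMulAct.mk x⁻¹) f g

theorem translate_smul (x : G) (c : ℂ) (f : Lp ℂ p m) :
    translate m x (c • f) = c • translate m x f :=
  smul_comm (DomMulAct.mk x⁻¹) c f

theorem norm_translate (x : G) (f : Lp ℂ p m) : ‖translate m x f‖ = ‖f‖ :=
  DomMulAct.norm_smul_Lp _ _

theorem continuous_translate (hp : p ≠ ∞) (f : Lp ℂ p m) : Continuous fun x => translate m x f := by
  have : Fact (p ≠ ∞) := ⟨hp⟩
  have h : Continuous fun x : G => DomMulAct.mk x⁻¹ := DomMulAct.continuous_mk.comp continuous_inv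
  exact h.smul continuous_const

theorem integrable_translateLp (hp : p ≠ ∞) (f : Lp ℂ p m) (v : Measure G) [IsFiniteMeasure v]
    [v.Regular] : Integrable (fun x => translate m x f) v :=
  Integrable.of_bound (aesm_of_continuous (continuous_translate m hp f) v) ‖f‖
    (ae_of_all _ fun x => (norm_translate m x f).le)

/-- The operator `f ↦ ∫ f (x⁻¹ ·) dv(x)`, for a positive finite regular measure `v`; an auxiliary
`L^p`-valued integral. -/
noncomputable def posOp (hp : p ≠ ∞) (v : Measure G) [IsFiniteMeasure v] [v.Regular] :
    Lp ℂ p m →L[ℂ] Lp ℂ p m :=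
  LinearMap.mkContinuous
    { toFun := fun f => ∫ x, translate m x f ∂v
      map_add' := by
        intro f g
        rw [← integral_add (integrable_translateLp m hp f v) (integrable_translateLp m hp g v)]
        exact integral_congr_ae (ae_of_all _ fun x => translate_add m x f g)
      map_smul' := by
        intro c f
        rw [RingHom.id_apply, ← integral_smul]
        exact integral_congr_ae (ae_of_all _ fun x => translate_smul m x c f) } (v.real Set.univ) (by
    intro f
    refine (norm_integral_le_of_norm_le_const
      (ae_of_all _ fun x => (norm_translate m x f).le)).trans ?_
    rw [mul_comm])

theorem posOp_apply (hp : p ≠ ∞) (v : Measure G) [IsFiniteMeasure v] [v.Regular] (f : Lp ℂ p m) :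
    posOp m hp v f = ∫ x, translate m x f ∂v := rfl

theorem norm_posOp_le (hp : p ≠ ∞) (v : Measure G) [IsFiniteMeasure v] [v.Regular] (f : Lp ℂ p m) :
    ‖posOp m hp v f‖ ≤ v.real Set.univ * ‖f‖ :=
  (LinearMap.mkContinuous_norm_le _ measureReal_nonneg _ |> fun h =>
    ((posOp m hp v).le_opNorm f).trans (by gcongr; exact h))

theorem enorm_posOp_le (hp : p ≠ ∞) (v : Measure G) [IsFiniteMeasure v] [v.Regular]
    (f : Lp ℂ p m) : ‖posOp m hp v f‖ₑ ≤ v Set.univ * ‖f‖ₑ := by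
  have h := ENNReal.ofReal_le_ofReal (norm_posOp_le m hp v f)
  rwa [ofReal_norm, ENNReal.ofReal_mul measureReal_nonneg, ofReal_norm, measureReal_def,
    ENNReal.ofReal_toReal (measure_ne_top _ _)] at h

theorem posOp_cc_restrict (hp : p ≠ ∞) (v : Measure G) [IsFiniteMeasure v] [v.Regular]
    {f : G → ℂ} (hf : Continuous f) (hc : HasCompactSupport f) (hm : MemLp f p m) (A : Set G)
    (hA : m A < ∞) :
    posOp m hp v (hm.toLp f) =ᵐ[m.restrict A] fun s => ∫ x, f (x⁻¹ * s) ∂v := by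
  have : IsFiniteMeasure (m.restrict A) := ⟨by simpa using hA⟩
  obtain ⟨C, hC⟩ := hf.bounded_above_of_compact_support hc
  let F (x : G) : BoundedContinuousFunction G ℂ := BoundedContinuousFunction.ofNormedAddCommGroup
    (fun s => f (x⁻¹ * s)) (hf.comp (continuous_const_mul _)) C fun s => hC _
  have hFc : Continuous F := by
    refine continuous_iff_continuousAt.2 fun x₀ => Metric.tendsto_nhds.2 fun ε hε => ?_
    filter_upwards [unif_left hf hc x₀ (half_pos hε)] with x hx
    refine lt_of_le_of_lt ((BoundedContinuousFunction.dist_le (half_pos hε).le).2 fun s => ?_)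
      (half_lt_self hε)
    rw [dist_eq_norm]
    exact (hx s).le
  have hFi : Integrable F v := Integrable.of_bound (aesm_of_continuous hFc v) C
    (ae_of_all _ fun x => BoundedContinuousFunction.norm_ofNormedAddCommGroup_le _
      ((norm_nonneg _).trans (hC 1)) _)
  let J : BoundedContinuousFunction G ℂ →L[ℂ] Lp ℂ p (m.restrict A) :=
    BoundedContinuousFunction.toLp p (m.restrict A) ℂ
  let R : Lp ℂ p m →L[ℂ] Lp ℂ p (m.restrict A) := LpToLpRestrictCLM G ℂ ℂ m p A
  have e1 (x : G) : R (translate m x (hm.toLp f)) = J (F x) := by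
    apply Lp.ext
    have a1 : R (translate m x (hm.toLp f)) =ᵐ[m.restrict A] translate m x (hm.toLp f) :=
      LpToLpRestrictCLM_coeFn ℂ A _
    have a2 : J (F x) =ᵐ[m.restrict A] F x := BoundedContinuousFunction.coeFn_toLp p _ ℂ _
    have a3 := ae_restrict_of_ae (s := A) (translate_ae m x (hm.toLp f))
    have a4 : ∀ᵐ s ∂m, (hm.toLp f) (x⁻¹ * s) = f (x⁻¹ * s) :=
      (measurePreserving_mul_left m x⁻¹).quasiMeasurePreserving.ae hm.coeFn_toLp
    filter_upwards [a1, a2, a3, ae_restrict_of_ae a4] with s h1 h2 h3 h4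
    rw [h1, h3, h4, h2]
    rfl
  have e2 : R (posOp m hp v (hm.toLp f)) = J (∫ x, F x ∂v) := by
    rw [posOp_apply, ← ContinuousLinearMap.integral_comp_comm _ (integrable_translateLp m hp _ v),
      ← ContinuousLinearMap.integral_comp_comm _ hFi]
    simp_rw [e1]
  have a1 : R (posOp m hp v (hm.toLp f)) =ᵐ[m.restrict A] posOp m hp v (hm.toLp f) :=
    LpToLpRestrictCLM_coeFn ℂ A _
  have a2 : J (∫ x, F x ∂v) =ᵐ[m.restrict A]
      ⇑(∫ x, F x ∂v : BoundedContinuousFunction G ℂ) :=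
    BoundedContinuousFunction.coeFn_toLp p _ ℂ _
  filter_upwards [a1, a2] with s h1 h2
  rw [← h1, e2, h2]
  exact (ContinuousLinearMap.integral_comp_comm (BoundedContinuousFunction.evalCLM ℂ s) hFi).symm

theorem posOp_cc (hp : p ≠ ∞) (v : Measure G) [IsFiniteMeasure v] [v.Regular]
    {f : G → ℂ} (hf : Continuous f) (hc : HasCompactSupport f) (hm : MemLp f p m) :
    posOp m hp v (hm.toLp f) =ᵐ[m] fun s => ∫ x, f (x⁻¹ * s) ∂v := by
  obtain ⟨K, hK, hae⟩ := exists_sigmaCompact_conull v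
  set T := posOp m hp v (hm.toLp f) with hT
  have hp0 : p ≠ 0 := (zero_lt_one.trans_le (Fact.out : 1 ≤ p)).ne'
  have h1 (n : ℕ) := ae_imp_of_ae_restrict (posOp_cc_restrict m hp v hf hc hm
    {s | ((n : ℝ≥0∞) + 1)⁻¹ ≤ ‖T s‖ₑ} (by
      have := (Lp.memLp T).meas_ge_lt_top_enorm hp0 hp (ε := ((n : ℝ≥0) + 1)⁻¹) (by positivity)
      rw [ENNReal.coe_inv (by positivity)] at this
      simpa using this))
  have h2 (n : ℕ) := ae_imp_of_ae_restrict (posOp_cc_restrict m hp v hf hc hm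
    (K n * tsupport f) ((hK n).mul hc).measure_lt_top)
  filter_upwards [ae_all_iff.2 h1, ae_all_iff.2 h2] with s hs1 hs2
  by_cases h0 : T s = 0
  · by_cases h3 : ∃ n, s ∈ K n * tsupport f
    · obtain ⟨n, hn⟩ := h3
      exact hs2 n hn
    · rw [h0]
      refine (integral_eq_zero_of_ae ?_).symm
      filter_upwards [hae] with x hx
      obtain ⟨n, hn⟩ := Set.mem_iUnion.1 hx
      by_contra h4
      exact h3 ⟨n, Set.mem_mul.2 ⟨x, hn, x⁻¹ * s, subset_tsupport f h4, by simp⟩⟩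
  · obtain ⟨n, hn⟩ := ENNReal.exists_inv_nat_lt (enorm_ne_zero.2 h0)
    exact hs1 n ((ENNReal.inv_le_inv.2 le_self_add).trans hn.le)

theorem exists_compact_cover (v : Measure G) [IsFiniteMeasure v] [v.Regular] {U : Set G}
    (hU : IsOpen U) (t : ℝ≥0∞) {s₀ : G} (hs : t < v {x | x⁻¹ * s₀ ∈ U}) :
    ∃ P ∈ 𝓝 s₀, ∃ L, IsCompact L ∧ L ⊆ U ∧ ∀ s ∈ P, t < v {x | x⁻¹ * s ∈ L} := by
  have ho : IsOpen {x : G | x⁻¹ * s₀ ∈ U} := hU.preimage (by fun_prop)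
  obtain ⟨K, hKU, hK, hlt⟩ := ho.exists_lt_isCompact hs
  have h1 : ∀ᶠ s in 𝓝 s₀, ∀ x ∈ K, x⁻¹ * s ∈ U := by
    refine hK.eventually_forall_of_forall_eventually fun x hx => ?_
    have hc : Continuous fun z : G × G => z.2⁻¹ * z.1 := by fun_prop
    exact hc.continuousAt.eventually (hU.mem_nhds (hKU hx))
  obtain ⟨P, hP, hPs, hPc⟩ := local_compact_nhds h1
  refine ⟨P, hP, K⁻¹ * P, hK.inv.mul hPc, ?_, fun s hs => hlt.trans_le (measure_mono ?_)⟩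
  · rintro _ ⟨y, hy, z, hz, rfl⟩
    simpa using hPs hz y⁻¹ hy
  · intro x hx
    exact Set.mul_mem_mul (Set.inv_mem_inv.2 hx) hs

theorem weak_type (v : Measure G) [IsFiniteMeasure v] [v.Regular] {U : Set G}
    (hU : IsOpen U) (t : ℝ≥0∞) :
    t * m {s | t < v {x | x⁻¹ * s ∈ U}} ≤ v Set.univ * m U := by
  have hW : IsOpen {s | t < v {x | x⁻¹ * s ∈ U}} := by
    refine isOpen_iff_mem_nhds.2 fun s₀ hs₀ => ?_
    obtain ⟨P, hP, L, -, hLU, hL⟩ := exists_compact_cover v hU t hs₀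
    exact mem_of_superset hP fun s hs => (hL s hs).trans_le (measure_mono fun x hx => hLU hx)
  rw [hW.measure_eq_iSup_isCompact, ENNReal.mul_iSup]
  refine iSup_le fun Q => ?_
  rw [ENNReal.mul_iSup]
  refine iSup_le fun hQW => ?_
  rw [ENNReal.mul_iSup]
  refine iSup_le fun hQ => ?_
  obtain ⟨L, hLc, hLU, hL⟩ : ∃ L, IsCompact L ∧ L ⊆ U ∧ ∀ s ∈ Q, t < v {x | x⁻¹ * s ∈ L} := by
    refine hQ.induction_on (p := fun Q => ∃ L, IsCompact L ∧ L ⊆ U ∧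
      ∀ s ∈ Q, t < v {x | x⁻¹ * s ∈ L}) ⟨∅, isCompact_empty, Set.empty_subset _, by simp⟩ ?_ ?_ ?_
    · rintro A B hAB ⟨L, h1, h2, h3⟩
      exact ⟨L, h1, h2, fun s hs => h3 s (hAB hs)⟩
    · rintro A B ⟨L, h1, h2, h3⟩ ⟨L', h1', h2', h3'⟩
      refine ⟨L ∪ L', h1.union h1', Set.union_subset h2 h2', fun s hs => ?_⟩
      rcases hs with hs | hs
      · exact (h3 s hs).trans_le (measure_mono fun x hx => Or.inl hx)
      · exact (h3' s hs).trans_le (measure_mono fun x hx => Or.inr hx)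
    · intro s hs
      obtain ⟨P, hP, L, h1, h2, h3⟩ := exists_compact_cover v hU t (hQW hs)
      exact ⟨P, mem_nhdsWithin_of_mem_nhds hP, L, h1, h2, h3⟩
  obtain ⟨φ, h1, h2, h3, h4⟩ := exists_continuousMap_one_of_isCompact_subset_isOpen hLc hU hLU
  have h2' : HasCompactSupport φ := h2
  set f : G → ℂ := fun x => (φ x : ℂ) with hfdef
  have hf : Continuous f := Complex.continuous_ofReal.comp φ.continuous
  have hc : HasCompactSupport f := h2'.comp_left (g := Complex.ofReal) Complex.ofReal_zero
  have hm : MemLp f 1 m := hf.memLp_of_hasCompactSupport hc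
  have key := posOp_cc m ENNReal.one_ne_top v hf hc hm
  set T := posOp m ENNReal.one_ne_top v (hm.toLp f) with hT
  have hfU : ‖hm.toLp f‖ₑ ≤ m U := by
    rw [Lp.enorm_toLp, eLpNorm_one_eq_lintegral_enorm]
    calc _ ≤ ∫⁻ x, U.indicator 1 x ∂m := by
          refine lintegral_mono fun x => ?_
          by_cases hx : x ∈ U
          · simp only [hx, Set.indicator_of_mem, Pi.one_apply, hfdef]
            rw [← ofReal_norm, Complex.norm_real, Real.norm_of_nonneg (h4 x).1]
            exact ENNReal.ofReal_le_one.2 (h4 x).2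
          · have : φ x = 0 := image_eq_zero_of_notMem_tsupport fun h => hx (h3 h)
            simp [hfdef, this]
      _ = m U := lintegral_indicator_one hU.measurableSet
  calc t * m Q ≤ ∫⁻ s in Q, ‖T s‖ₑ ∂m := by
        rw [← setLIntegral_const]
        refine setLIntegral_mono_ae' hQ.measurableSet ?_
        filter_upwards [key] with s hs hsQ
        refine (hL s hsQ).le.trans ?_
        have e1 : (∫ x, f (x⁻¹ * s) ∂v) = ((∫ x, φ (x⁻¹ * s) ∂v : ℝ) : ℂ) := integral_ofReal
        have e2 : 0 ≤ ∫ x, φ (x⁻¹ * s) ∂v := integral_nonneg fun x => (h4 _).1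
        have hφi : Integrable (fun x => φ (x⁻¹ * s)) v :=
          Integrable.of_bound (C := 1) (by
            have : Continuous fun x => φ (x⁻¹ * s) := by fun_prop
            exact this.aestronglyMeasurable) (ae_of_all _ fun x => by
              rw [Real.norm_of_nonneg (h4 _).1]; exact (h4 _).2)
        rw [hs, e1, ← ofReal_norm, Complex.norm_real, Real.norm_of_nonneg e2,
          ofReal_integral_eq_lintegral_ofReal hφi (ae_of_all _ fun x => (h4 _).1)]
        have hLm : MeasurableSet {x : G | x⁻¹ * s ∈ L} :=
          (hLc.isClosed.preimage (by fun_prop : Continuous fun x : G => x⁻¹ * s)).measurableSet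
        rw [← lintegral_indicator_one hLm]
        refine lintegral_mono fun x => ?_
        by_cases hx : x⁻¹ * s ∈ L
        · have : φ (x⁻¹ * s) = 1 := h1 hx
          simp [Set.indicator, hx, this]
        · simp [Set.indicator, hx]
    _ ≤ ∫⁻ s, ‖T s‖ₑ ∂m := setLIntegral_le_lintegral _ _
    _ = ‖T‖ₑ := by rw [Lp.enorm_def, eLpNorm_one_eq_lintegral_enorm]
    _ ≤ v Set.univ * ‖hm.toLp f‖ₑ := enorm_posOp_le m _ v _
    _ ≤ _ := by gcongr

theorem ae_null_translate (v : Measure G) [IsFiniteMeasure v] [v.Regular] {N : Set G}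
    (hN : m N = 0) : ∀ᵐ s ∂m, v {x | x⁻¹ * s ∈ N} = 0 := by
  have h (n : ℕ) : m {s | ((n : ℝ≥0∞) + 1)⁻¹ < v {x | x⁻¹ * s ∈ N}} = 0 := by
    set t := ((n : ℝ≥0∞) + 1)⁻¹ with ht
    have ht0 : t ≠ 0 := by simp [ht]
    have key : ∀ ε : ℝ≥0, 0 < ε → t * m {s | t < v {x | x⁻¹ * s ∈ N}} ≤ v Set.univ * ε := by
      intro ε hε
      obtain ⟨U, hNU, hU, hlt⟩ := Set.exists_isOpen_lt_of_lt N (μ := m) (ε : ℝ≥0∞) (by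
        rw [hN]; exact_mod_cast hε)
      calc _ ≤ t * m {s | t < v {x | x⁻¹ * s ∈ U}} := by
            gcongr
        _ ≤ v Set.univ * m U := weak_type m v hU t
        _ ≤ _ := by gcongr
    have h0 : t * m {s | t < v {x | x⁻¹ * s ∈ N}} ≤ 0 := by
      have hlim : Tendsto (fun ε : ℝ≥0 => v Set.univ * (ε : ℝ≥0∞)) (𝓝[>] 0) (𝓝 0) := by
        have h5 : Tendsto (fun ε : ℝ≥0 => v Set.univ * (ε : ℝ≥0∞)) (𝓝 0)
            (𝓝 (v Set.univ * ((0 : ℝ≥0) : ℝ≥0∞))) :=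
          ENNReal.Tendsto.const_mul (ENNReal.tendsto_coe.2 tendsto_id)
            (Or.inr (measure_ne_top _ _))
        simpa using h5.mono_left nhdsWithin_le_nhds
      exact ge_of_tendsto hlim (eventually_nhdsWithin_of_forall fun ε hε => key ε hε)
    simpa [ht0] using h0
  have h' := ae_all_iff.2 fun n => (measure_eq_zero_iff_ae_notMem.1 (h n))
  filter_upwards [h'] with s hs
  by_contra h0
  obtain ⟨n, hn⟩ := ENNReal.exists_inv_nat_lt h0
  exact hs n (lt_of_le_of_lt (ENNReal.inv_le_inv.2 le_self_add) hn)

theorem exists_cc_approx (hp : p ≠ ∞) {f : G → ℂ} (hf : MemLp f p m) {ε : ℝ≥0∞} (hε : ε ≠ 0) :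
    ∃ g : G → ℂ, HasCompactSupport g ∧ eLpNorm (f - g) p m ≤ ε ∧ Continuous g ∧ MemLp g p m := by
  suffices H : ∃ g : G → ℂ, eLpNorm (f - g) p m ≤ ε ∧ Continuous g ∧ MemLp g p m ∧
      HasCompactSupport g by
    rcases H with ⟨g, hg, g_cont, g_mem, g_support⟩
    exact ⟨g, g_support, hg, g_cont, g_mem⟩
  apply hf.induction_dense hp _ _ _ _ hε
  rotate_left
  · rintro f g ⟨f_cont, f_mem, hf⟩ ⟨g_cont, g_mem, hg⟩
    exact ⟨f_cont.add g_cont, f_mem.add g_mem, hf.add hg⟩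
  · rintro f ⟨_, f_mem, _⟩
    exact f_mem.aestronglyMeasurable
  intro c t ht htm ε hε
  rcases exists_Lp_half ℂ m p hε with ⟨δ, δpos, hδ⟩
  obtain ⟨η, ηpos, hη⟩ := exists_eLpNorm_indicator_le (μ := m) hp c δpos.ne'
  have hη0 : (η : ℝ≥0∞) ≠ 0 := by exact_mod_cast ηpos.ne'
  obtain ⟨s, st, hs, hts⟩ := ht.exists_isCompact_sdiff_lt htm.ne hη0
  have hsm : m s < ∞ := hs.measure_lt_top
  obtain ⟨U, hsU, hU, hlt⟩ := s.exists_isOpen_lt_add hsm.ne hη0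
  have hUs : m (U \ s) ≤ η := by
    rw [measure_sdiff hsU hs.measurableSet.nullMeasurableSet hsm.ne]
    exact tsub_le_iff_left.2 hlt.le
  obtain ⟨φ, h1, h2, h3, h4⟩ := exists_continuousMap_one_of_isCompact_subset_isOpen hs hU hsU
  have h2' : HasCompactSupport φ := h2
  have hgc : Continuous fun x => (φ x : ℂ) * c := by fun_prop
  have hgs : HasCompactSupport fun x => (φ x : ℂ) * c :=
    h2'.comp_left (g := fun r : ℝ => (r : ℂ) * c) (by simp)
  have hgm : MemLp (fun x => (φ x : ℂ) * c) p m := hgc.memLp_of_hasCompactSupport hgs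
  have I1 : eLpNorm ((s.indicator fun _ => c) - t.indicator fun _ => c) p m ≤ δ := by
    rw [← eLpNorm_neg, neg_sub, ← Set.indicator_sdiff st]
    exact hη _ hts.le
  have I2 : eLpNorm ((fun x => (φ x : ℂ) * c) - s.indicator fun _ => c) p m ≤ δ := by
    refine (eLpNorm_mono fun x => ?_).trans (hη (U \ s) hUs)
    by_cases hx : x ∈ s
    · have : φ x = 1 := h1 hx
      simp [hx, this]
    · by_cases hxU : x ∈ U
      · simp only [Pi.sub_apply, hx, not_false_eq_true, Set.indicator_of_notMem, sub_zero,
          norm_mul, Complex.norm_real, Real.norm_of_nonneg (h4 x).1]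
        rw [Set.indicator_of_mem (show x ∈ U \ s from ⟨hxU, hx⟩)]
        exact mul_le_of_le_one_left (norm_nonneg _) (h4 x).2
      · have : φ x = 0 := image_eq_zero_of_notMem_tsupport fun h => hxU (h3 h)
        simp [hx, this]
  refine ⟨fun x => (φ x : ℂ) * c, ?_, hgc, hgm, hgs⟩
  have h5 := (hδ _ _ (hgm.aestronglyMeasurable.sub
      (aestronglyMeasurable_const.indicator hs.measurableSet))
    ((aestronglyMeasurable_const.indicator hs.measurableSet).sub
      (aestronglyMeasurable_const.indicator ht)) I2 I1).le
  rwa [sub_add_sub_cancel] at h5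

theorem posOp_ae (hp : p ≠ ∞) (v : Measure G) [IsFiniteMeasure v] [v.Regular] (f : Lp ℂ p m) :
    ∀ᵐ s ∂m, Integrable (fun x => f (x⁻¹ * s)) v ∧ posOp m hp v f s = ∫ x, f (x⁻¹ * s) ∂v := by
  obtain ⟨ε, hε, hεsum⟩ := ENNReal.exists_pos_sum_of_countable (one_ne_zero' ℝ≥0∞) ℕ
  have hε0 (n : ℕ) : (ε n : ℝ≥0∞) ≠ 0 := by exact_mod_cast (hε n).ne'
  choose g hgc hgε hg hgm using fun n =>
    exists_cc_approx m hp (Lp.memLp f) (hε0 n)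
  let T := posOp m hp v
  let e (n : ℕ) : Lp ℂ p m := f - (hgm n).toLp (g n)
  have he (n : ℕ) : ‖e n‖ₑ ≤ ε n := by
    rw [Lp.enorm_def]
    refine le_trans (le_of_eq (eLpNorm_congr_ae ?_)) (hgε n)
    filter_upwards [Lp.coeFn_sub f ((hgm n).toLp (g n)), (hgm n).coeFn_toLp] with s h1 h2
    rw [h1, Pi.sub_apply, h2, Pi.sub_apply]
  have hesum : ∑' n, ‖e n‖ₑ ≠ ∞ :=
    ((ENNReal.tsum_le_tsum he).trans_lt (hεsum.trans ENNReal.one_lt_top)).ne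
  have hTesum : ∑' n, ‖T (e n)‖ₑ ≠ ∞ := by
    refine ((ENNReal.tsum_le_tsum fun n => enorm_posOp_le m hp v (e n)).trans_lt ?_).ne
    rw [ENNReal.tsum_mul_left]
    exact ENNReal.mul_lt_top (measure_lt_top _ _) hesum.lt_top
  -- the approximations converge almost everywhere
  have hge : ∀ᵐ y ∂m, Tendsto (fun n => g n y) atTop (𝓝 (f y)) := by
    have h1 : ∀ᵐ y ∂m, ∀ n, e n y = f y - g n y := ae_all_iff.2 fun n => by
      filter_upwards [Lp.coeFn_sub f ((hgm n).toLp (g n)), (hgm n).coeFn_toLp] with s h1 h2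
      rw [h1, Pi.sub_apply, h2]
    filter_upwards [Lp.hasSum_coeFn_tsum hesum, h1] with y h2 h3
    have h4 := h2.summable.tendsto_atTop_zero
    simp only [h3] at h4
    simpa using (tendsto_const_nhds (x := f y)).sub h4
  have hTge : ∀ᵐ s ∂m, Tendsto (fun n => ∫ x, g n (x⁻¹ * s) ∂v) atTop (𝓝 (T f s)) := by
    have h1 : ∀ᵐ y ∂m, ∀ n, T (e n) y = T f y - ∫ x, g n (x⁻¹ * y) ∂v :=
      ae_all_iff.2 fun n => by
        have h0 : T (e n) = T f - T ((hgm n).toLp (g n)) := map_sub _ _ _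
        rw [h0]
        filter_upwards [Lp.coeFn_sub (T f) (T ((hgm n).toLp (g n))),
          posOp_cc m hp v (hg n) (hgc n) (hgm n)] with s h1 h2
        rw [h1, Pi.sub_apply, h2]
    filter_upwards [Lp.hasSum_coeFn_tsum hTesum, h1] with y h2 h3
    have h4 := h2.summable.tendsto_atTop_zero
    simp only [h3] at h4
    simpa using (tendsto_const_nhds (x := T f y)).sub h4
  -- the increments
  let u (n : ℕ) : G → ℂ := fun s => (‖g (n + 1) s - g n s‖ : ℂ)
  have huc (n : ℕ) : Continuous (u n) :=
    Complex.continuous_ofReal.comp ((hg (n + 1)).sub (hg n)).norm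
  have hus (n : ℕ) : HasCompactSupport (u n) := by
    have h1 : HasCompactSupport (g (n + 1) - g n) := (hgc (n + 1)).sub (hgc n)
    exact h1.comp_left (g := fun z : ℂ => ((‖z‖ : ℝ) : ℂ)) (by simp)
  have hum (n : ℕ) : MemLp (u n) p m := (huc n).memLp_of_hasCompactSupport (hus n)
  have hu (n : ℕ) : ‖(hum n).toLp (u n)‖ₑ ≤ ε n + ε (n + 1) := by
    have h1 : ‖(hum n).toLp (u n)‖ₑ ≤ ‖e n - e (n + 1)‖ₑ := by
      rw [Lp.enorm_def, Lp.enorm_def]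
      refine eLpNorm_mono_ae ?_
      filter_upwards [Lp.coeFn_sub f ((hgm n).toLp (g n)), (hgm n).coeFn_toLp,
        Lp.coeFn_sub f ((hgm (n + 1)).toLp (g (n + 1))), (hgm (n + 1)).coeFn_toLp,
        (hum n).coeFn_toLp, Lp.coeFn_sub (e n) (e (n + 1))] with s h1 h2 h3 h4 h5 h6
      rw [h5, h6, Pi.sub_apply, h1, h3, Pi.sub_apply, Pi.sub_apply, h2, h4]
      simp [u]
    refine h1.trans ((enorm_sub_le).trans (add_le_add (he n) (he (n + 1))))
  have hTusum : ∑' n, ‖T ((hum n).toLp (u n))‖ₑ ≠ ∞ := by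
    refine ((ENNReal.tsum_le_tsum fun n => (enorm_posOp_le m hp v _).trans
      (mul_le_mul_right (hu n) _)).trans_lt ?_).ne
    rw [ENNReal.tsum_mul_left, ENNReal.tsum_add]
    refine ENNReal.mul_lt_top (measure_lt_top _ _) (ENNReal.add_lt_top.2
      ⟨hεsum.trans ENNReal.one_lt_top, ?_⟩)
    exact (ENNReal.tsum_comp_le_tsum_of_injective (add_left_injective 1)
      (fun n => (ε n : ℝ≥0∞))).trans_lt (hεsum.trans ENNReal.one_lt_top)
  have hTu : ∀ᵐ s ∂m, Summable fun n => ∫ x, u n (x⁻¹ * s) ∂v := by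
    have h1 : ∀ᵐ s ∂m, ∀ n, T ((hum n).toLp (u n)) s = ∫ x, u n (x⁻¹ * s) ∂v :=
      ae_all_iff.2 fun n => posOp_cc m hp v (huc n) (hus n) (hum n)
    filter_upwards [Lp.hasSum_coeFn_tsum hTusum, h1] with s h2 h3
    simpa only [h3] using h2.summable
  have hgv := ae_null_translate m v (N := {y | ¬ Tendsto (fun n => g n y) atTop (𝓝 (f y))}) hge
  filter_upwards [hTge, hTu, hgv] with s h1 h2 h3
  have hlim : ∀ᵐ x ∂v, Tendsto (fun n => g n (x⁻¹ * s)) atTop (𝓝 (f (x⁻¹ * s))) := h3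
  have hcts {h : G → ℂ} (hh : Continuous h) : Continuous fun x => h (x⁻¹ * s) := by fun_prop
  have hgi (n : ℕ) : Integrable (fun x => g n (x⁻¹ * s)) v := by
    obtain ⟨C, hC⟩ := (hg n).bounded_above_of_compact_support (hgc n)
    exact Integrable.of_bound (hcts (hg n)).aestronglyMeasurable C (ae_of_all _ fun x => hC _)
  have hdi (n : ℕ) : Integrable (fun x => ‖g (n + 1) (x⁻¹ * s) - g n (x⁻¹ * s)‖) v :=
    ((hgi (n + 1)).sub (hgi n)).norm
  have hds : Summable fun n => ∫ x, ‖g (n + 1) (x⁻¹ * s) - g n (x⁻¹ * s)‖ ∂v := by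
    have : (fun n => ∫ x, u n (x⁻¹ * s) ∂v) =
        fun n => ((∫ x, ‖g (n + 1) (x⁻¹ * s) - g n (x⁻¹ * s)‖ ∂v : ℝ) : ℂ) := by
      ext n
      exact integral_ofReal
    rw [this] at h2
    exact_mod_cast h2
  have hfin : ∑' n, ∫⁻ x, ‖g (n + 1) (x⁻¹ * s) - g n (x⁻¹ * s)‖ₑ ∂v ≠ ∞ := by
    have h4 (n : ℕ) : ∫⁻ x, ‖g (n + 1) (x⁻¹ * s) - g n (x⁻¹ * s)‖ₑ ∂v =
        ENNReal.ofReal (∫ x, ‖g (n + 1) (x⁻¹ * s) - g n (x⁻¹ * s)‖ ∂v) := by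
      rw [ofReal_integral_eq_lintegral_ofReal (hdi n) (ae_of_all _ fun x => norm_nonneg _)]
      simp
    simp_rw [h4]
    exact hds.tsum_ofReal_ne_top
  let B (x : G) : ℝ≥0∞ := ‖g 0 (x⁻¹ * s)‖ₑ + ∑' n, ‖g (n + 1) (x⁻¹ * s) - g n (x⁻¹ * s)‖ₑ
  have hmeas (n : ℕ) : AEMeasurable (fun x => ‖g (n + 1) (x⁻¹ * s) - g n (x⁻¹ * s)‖ₑ) v :=
    ((hgi (n + 1)).sub (hgi n)).aestronglyMeasurable.enorm
  have hBm : AEMeasurable B v :=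
    (hgi 0).aestronglyMeasurable.enorm.add (AEMeasurable.tsum hmeas)
  have hB : ∫⁻ x, B x ∂v ≠ ∞ := by
    rw [lintegral_add_left' (hgi 0).aestronglyMeasurable.enorm, lintegral_tsum hmeas]
    exact ENNReal.add_ne_top.2 ⟨(hgi 0).hasFiniteIntegral.ne, hfin⟩
  have hgB (n : ℕ) (x : G) : ‖g n (x⁻¹ * s)‖ₑ ≤ B x := by
    have h5 : ‖g n (x⁻¹ * s)‖ₑ ≤ ‖g 0 (x⁻¹ * s)‖ₑ +
        ∑ k ∈ Finset.range n, ‖g (k + 1) (x⁻¹ * s) - g k (x⁻¹ * s)‖ₑ := by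
      induction n with
      | zero => simp
      | succ n ih =>
        rw [Finset.sum_range_succ, ← add_assoc]
        calc ‖g (n + 1) (x⁻¹ * s)‖ₑ
            = ‖g n (x⁻¹ * s) + (g (n + 1) (x⁻¹ * s) - g n (x⁻¹ * s))‖ₑ := by
              rw [add_sub_cancel]
          _ ≤ _ := (enorm_add_le _ _).trans (by gcongr)
    exact h5.trans (add_le_add le_rfl (ENNReal.sum_le_tsum _))
  have hBfin : ∀ᵐ x ∂v, B x < ∞ := ae_lt_top' hBm hB
  have hBi : Integrable (fun x => (B x).toReal) v := integrable_toReal_of_lintegral_ne_top hBm hB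
  have hbound (n : ℕ) : ∀ᵐ x ∂v, ‖g n (x⁻¹ * s)‖ ≤ (B x).toReal := by
    filter_upwards [hBfin] with x hx
    rw [← toReal_enorm]
    exact ENNReal.toReal_mono hx.ne (hgB n x)
  have hint := tendsto_integral_of_dominated_convergence (fun x => (B x).toReal)
    (fun n => (hgi n).aestronglyMeasurable) hBi hbound hlim
  refine ⟨hBi.mono' (aestronglyMeasurable_of_tendsto_ae atTop
    (fun n => (hgi n).aestronglyMeasurable) hlim) ?_, tendsto_nhds_unique h1 hint⟩
  filter_upwards [hlim, ae_all_iff.2 hbound] with x h5 h6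
  exact le_of_tendsto h5.norm (Eventually.of_forall h6)

theorem exists_convOp (hp : p ≠ ∞) (μ : M G) : ∃ T : Lp ℂ p m →L[ℂ] Lp ℂ p m,
    ∀ f : Lp ℂ p m, T f =ᵐ[m] fun s => cint μ.1 fun x => f (x⁻¹ * s) := by
  obtain ⟨ρ, h1, h2, h3, h4⟩ := exists_decomp μ
  refine ⟨∑ k, coef k • posOp m hp (ρ k), fun f => ?_⟩
  have ha : ∀ᵐ s ∂m, ∀ k, Integrable (fun x => f (x⁻¹ * s)) (ρ k) ∧
      posOp m hp (ρ k) f s = ∫ x, f (x⁻¹ * s) ∂(ρ k) :=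
    ae_all_iff.2 fun k => posOp_ae m hp (ρ k) f
  have hb : ∀ᵐ s ∂m, ((∑ k, coef k • posOp m hp (ρ k)) f : Lp ℂ p m) s =
      ∑ k, coef k * posOp m hp (ρ k) f s := by
    simp only [Fin.sum_univ_four, _root_.add_apply, _root_.smul_apply]
    have e (k) := Lp.coeFn_smul (coef k) (posOp m hp (ρ k) f)
    filter_upwards [e 0, e 1, e 2, e 3,
      Lp.coeFn_add (coef 0 • posOp m hp (ρ 0) f) (coef 1 • posOp m hp (ρ 1) f),
      Lp.coeFn_add (coef 0 • posOp m hp (ρ 0) f + coef 1 • posOp m hp (ρ 1) f)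
        (coef 2 • posOp m hp (ρ 2) f),
      Lp.coeFn_add (coef 0 • posOp m hp (ρ 0) f + coef 1 • posOp m hp (ρ 1) f +
        coef 2 • posOp m hp (ρ 2) f) (coef 3 • posOp m hp (ρ 3) f)] with s e0 e1 e2 e3 a1 a2 a3
    rw [a3, Pi.add_apply, a2, Pi.add_apply, a1, Pi.add_apply, e0, e1, e2, e3]
    simp
  filter_upwards [ha, hb] with s h5 h6
  rw [h6, cint_eq_sum μ.1 _ ρ h4 fun k => (h5 k).1]
  exact Finset.sum_congr rfl fun k _ => by rw [(h5 k).2]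

/-- The convolution operator `λ_p(μ) : L^p(G) → L^p(G)`, `1 ≤ p < ∞`: the (unique) bounded operator
with `(λ_p(μ) f)(s) = ∫ f (x⁻¹ s) dμ(x)` for almost every `s`. -/
noncomputable def convOp (hp : p ≠ ∞) (μ : M G) : Lp ℂ p m →L[ℂ] Lp ℂ p m :=
  (exists_convOp m hp μ).choose

theorem convOp_ae (hp : p ≠ ∞) (μ : M G) (f : Lp ℂ p m) :
    convOp m hp μ f =ᵐ[m] fun s => cint μ.1 fun x => f (x⁻¹ * s) :=
  (exists_convOp m hp μ).choose_spec f

end Young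

section Operators

variable {X : Type*} [NormedAddCommGroup X] [NormedSpace ℂ X]

/-- The Cesàro means `(T + T ^ 2 + ⋯ + T ^ n) / n` of an operator. -/
noncomputable def opCesaro (T : X →L[ℂ] X) (n : ℕ) : X →L[ℂ] X :=
  (n : ℂ)⁻¹ • ∑ k ∈ Finset.range n, T ^ (k + 1)

/-- Weak mean ergodicity: convergence of the Cesàro means in the weak operator topology. -/
def WeaklyMeanErgodic (T : X →L[ℂ] X) : Prop :=
  ∃ P : X →L[ℂ] X, Tendsto (fun n => ContinuousLinearMapWOT.ofCLM (opCesaro T n)) atTop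
    (𝓝 (ContinuousLinearMapWOT.ofCLM P))

/-- Mean ergodicity: convergence of the Cesàro means in the strong operator topology. -/
def MeanErgodic (T : X →L[ℂ] X) : Prop :=
  ∃ P : X →L[ℂ] X, ∀ x, Tendsto (fun n => opCesaro T n x) atTop (𝓝 (P x))

end Operators

end VagueErgodic

namespace VagueErgodic

instance instIsFiniteMeasureVariation {X : Type*} [MeasurableSpace X] (μ : ComplexMeasure X) :
    IsFiniteMeasure μ.variation := isFiniteMeasure_variation μ

instance instRegularVariation {G : Type*} [TopologicalSpace G] [T2Space G] [MeasurableSpace G]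
    [BorelSpace G] (μ : M G) : μ.1.variation.Regular := μ.2

section Integral

set_option linter.unusedSectionVars false

variable {G : Type*} [Group G] [TopologicalSpace G] [IsTopologicalGroup G] [LocallyCompactSpace G]
  [T2Space G] [MeasurableSpace G] [BorelSpace G]

theorem integrable_of_continuous_of_bound (κ : M G) {φ : G → ℂ} (hφ : Continuous φ) {C : ℝ}
    (hC : ∀ x, ‖φ x‖ ≤ C) : κ.1.Integrable φ :=
  MeasureTheory.Integrable.of_bound (aesm_of_continuous hφ κ.1.variation) C (ae_of_all _ hC)

theorem norm_cint_le_integral {X : Type*} [MeasurableSpace X] (κ : ComplexMeasure X) (φ : X → ℂ) :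
    ‖cint κ φ‖ ≤ ∫ x, ‖φ x‖ ∂κ.variation := by
  refine VectorMeasure.norm_integral_le_integral_norm.trans ?_
  exact mul_le_of_le_one_left (integral_nonneg fun _ => norm_nonneg _)
    (ContinuousLinearMap.opNorm_mul_le ℝ ℂ)

theorem norm_cint_le {X : Type*} [MeasurableSpace X] (κ : ComplexMeasure X) {φ : X → ℂ} {C : ℝ}
    (hC : ∀ᵐ x ∂κ.variation, ‖φ x‖ ≤ C) : ‖cint κ φ‖ ≤ C * κ.variation.real Set.univ :=
  (norm_cint_le_integral κ φ).trans <| by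
    have := norm_integral_le_of_norm_le_const (μ := κ.variation) (f := fun x => ‖φ x‖) (C := C)
      (by simpa using hC)
    exact (le_abs_self _).trans this

theorem cint_add {X : Type*} [MeasurableSpace X] (κ : ComplexMeasure X) {φ ψ : X → ℂ}
    (hφ : κ.Integrable φ) (hψ : κ.Integrable ψ) :
    cint κ (fun x => φ x + ψ x) = cint κ φ + cint κ ψ :=
  VectorMeasure.integral_fun_add hφ hψ

theorem cint_sub {X : Type*} [MeasurableSpace X] (κ : ComplexMeasure X) {φ ψ : X → ℂ}
    (hφ : κ.Integrable φ) (hψ : κ.Integrable ψ) :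
    cint κ (fun x => φ x - ψ x) = cint κ φ - cint κ ψ :=
  VectorMeasure.integral_fun_sub hφ hψ

theorem cint_const_mul (κ : M G) {φ : G → ℂ} (hφ : κ.1.Integrable φ) (c : ℂ) :
    cint κ.1 (fun x => c * φ x) = c * cint κ.1 φ := by
  obtain ⟨ρ, h1, h2, h3, h4⟩ := exists_decomp κ
  have hi k : MeasureTheory.Integrable φ (ρ k) := MeasureTheory.Integrable.mono_measure hφ (h3 k)
  rw [cint_eq_sum κ.1 _ ρ h4 hi, cint_eq_sum κ.1 _ ρ h4 fun k => (hi k).const_mul c,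
    Finset.mul_sum]
  refine Finset.sum_congr rfl fun k _ => ?_
  rw [integral_const_mul]
  ring

theorem cint_smul_measure (κ : M G) {φ : G → ℂ} (hφ : κ.1.Integrable φ) (c : ℂ) :
    cint (c • κ).1 φ = c * cint κ.1 φ := by
  obtain ⟨ρ, h1, h2, h3, h4⟩ := exists_decomp κ
  have hi k : MeasureTheory.Integrable φ (ρ k) := MeasureTheory.Integrable.mono_measure hφ (h3 k)
  rw [cint_eq_sum κ.1 _ ρ h4 hi, cint_eq_sum (c • κ).1 (fun k => c * coef k) ρ (fun s hs => ?_) hi,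
    Finset.mul_sum]
  · exact Finset.sum_congr rfl fun k _ => by ring
  · have : (c • κ).1 s = c * κ.1 s := rfl
    rw [this, h4 s hs, Finset.mul_sum]
    exact Finset.sum_congr rfl fun k _ => by ring

theorem cint_sum_measure {ι : Type*} (s : Finset ι) (κ : ι → M G) {φ : G → ℂ}
    (hκ : ∀ i, (κ i).1.Integrable φ) : cint (∑ i ∈ s, κ i).1 φ = ∑ i ∈ s, cint (κ i).1 φ := by
  have : (∑ i ∈ s, κ i).1 = ∑ i ∈ s, (κ i).1 := by simp
  rw [this]
  exact VectorMeasure.integral_finsetSum_vectorMeasure fun i _ => hκ i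

/-- The radial retraction of `ℂ` onto the closed unit disc. -/
noncomputable def unitTrunc (z : ℂ) : ℂ := ((max 1 ‖z‖ : ℝ) : ℂ)⁻¹ * z

theorem continuous_unitTrunc : Continuous unitTrunc := by
  refine Continuous.mul (Continuous.inv₀ (by fun_prop) fun z => ?_) continuous_id
  exact_mod_cast (lt_max_of_lt_left one_pos).ne'

theorem norm_unitTrunc_le (z : ℂ) : ‖unitTrunc z‖ ≤ 1 := by
  have h : 0 < max 1 ‖z‖ := lt_max_of_lt_left one_pos
  rw [unitTrunc, norm_mul, norm_inv, Complex.norm_real, Real.norm_of_nonneg h.le,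
    inv_mul_le_iff₀ h, mul_one]
  exact le_max_right _ _

theorem norm_unitTrunc_sub_le (z : ℂ) {w : ℂ} (hw : ‖w‖ ≤ 1) :
    ‖unitTrunc z - w‖ ≤ 2 * ‖w - z‖ := by
  have h : 0 < max 1 ‖z‖ := lt_max_of_lt_left one_pos
  have h1 : ‖unitTrunc z - z‖ ≤ ‖w - z‖ := by
    have e : unitTrunc z - z = (((max 1 ‖z‖ : ℝ)⁻¹ - 1 : ℝ) : ℂ) * z := by
      rw [unitTrunc]; push_cast; ring
    rcases le_total ‖z‖ 1 with hz | hz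
    · rw [e, max_eq_left hz]; simp
    · have h0 : 0 < ‖z‖ := by linarith
      rw [e, max_eq_right hz, norm_mul, Complex.norm_real, Real.norm_of_nonpos
        (by simpa using inv_le_one_of_one_le₀ hz), neg_sub, sub_mul, inv_mul_cancel₀ h0.ne', one_mul]
      have := norm_sub_norm_le z w
      rw [norm_sub_rev] at this
      linarith
  calc _ = ‖(unitTrunc z - z) + -(w - z)‖ := by ring_nf
    _ ≤ _ := (norm_add_le _ _).trans (by rw [norm_neg]; linarith)

theorem exists_norm_le_one_mul_eq_norm (z : ℂ) : ∃ c : ℂ, ‖c‖ ≤ 1 ∧ c * z = ‖z‖ := by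
  by_cases hz : z = 0
  · exact ⟨0, by simp, by simp [hz]⟩
  · have h : (‖z‖ : ℂ) ≠ 0 := by simpa using hz
    refine ⟨(‖z‖ : ℂ)⁻¹ * (starRingEnd ℂ) z, by simp [hz], ?_⟩
    rw [mul_assoc, mul_comm _ z, Complex.mul_conj']
    field_simp

/-- A measurable set can be approximated in measure by Urysohn functions. -/
theorem exists_cc_indicator_integral_sub_le (v : Measure G) [IsFiniteMeasure v] [v.Regular]
    {s : Set G} (hs : MeasurableSet s) {ε : ℝ} (hε : 0 < ε) :
    ∃ φ : C(G, ℝ), HasCompactSupport φ ∧ ∫ x, |s.indicator 1 x - φ x| ∂v ≤ ε := by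
  obtain ⟨K, hKs, hK, hlt⟩ := hs.exists_isCompact_sdiff_lt
    (measure_ne_top v s) (ε := ENNReal.ofReal (ε / 2)) (by simpa using hε)
  obtain ⟨U, hKU, hU, hUlt⟩ := K.exists_isOpen_lt_add (μ := v) (measure_ne_top v K)
    (ε := ENNReal.ofReal (ε / 2)) (by simpa using hε)
  obtain ⟨φ, h1, h2, h3, h4⟩ := exists_continuousMap_one_of_isCompact_subset_isOpen hK hU hKU
  have h2' : HasCompactSupport φ := h2
  refine ⟨φ, h2', ?_⟩
  have hUK : v.real (U \ K) ≤ ε / 2 := by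
    refine ENNReal.toReal_le_of_le_ofReal (by positivity) ?_
    rw [measure_sdiff hKU hK.measurableSet.nullMeasurableSet (measure_ne_top _ _)]
    exact tsub_le_iff_left.2 hUlt.le
  have hsK : v.real (s \ K) ≤ ε / 2 := ENNReal.toReal_le_of_le_ofReal (by positivity) hlt.le
  have i1 : Integrable ((s \ K).indicator fun _ => (1 : ℝ)) v :=
    (integrable_const _).indicator (hs.diff hK.measurableSet)
  have i2 : Integrable ((U \ K).indicator fun _ => (1 : ℝ)) v :=
    (integrable_const _).indicator (hU.measurableSet.diff hK.measurableSet)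
  have i3 : Integrable (s.indicator (1 : G → ℝ)) v := (integrable_const _).indicator hs
  have i4 : Integrable φ v := integrable_of_cc φ.continuous h2' v
  calc _ ≤ ∫ x, ((s \ K).indicator (fun _ => (1 : ℝ)) x + (U \ K).indicator (fun _ => (1 : ℝ)) x) ∂v := by
        refine integral_mono (i3.sub i4).abs (i1.add i2) fun x => ?_
        dsimp only
        by_cases hxK : x ∈ K
        · have e : φ x = 1 := h1 hxK
          simp [hxK, hKs hxK, e]
        · have hb := h4 x
          by_cases hxU : x ∈ U
          · by_cases hxs : x ∈ s
            · simp only [hxs, hxK, hxU, Set.indicator_of_mem, Set.mem_sdiff, not_false_eq_true,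
                and_self, Pi.one_apply]
              exact abs_le.2 ⟨by linarith [hb.2], by linarith [hb.1]⟩
            · simp [hxs, hxK, hxU, abs_of_nonneg hb.1, hb.2]
          · have e : φ x = 0 := image_eq_zero_of_notMem_tsupport fun h => hxU (h3 h)
            by_cases hxs : x ∈ s <;> simp [hxs, hxK, hxU, e]
    _ = v.real (s \ K) + v.real (U \ K) := by
        rw [integral_add i1 i2, integral_indicator_const _ (hs.diff hK.measurableSet),
          integral_indicator_const _ (hU.measurableSet.diff hK.measurableSet)]
        simp
    _ ≤ ε := by linarith

/-- The total variation of an open set is the norm of the functional on the functions supported in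
that set. -/
theorem variation_le_of_forall_norm_cint_le (κ : M G) {U : Set G} (hU : IsOpen U) {C : ℝ}
    (h : ∀ f : G → ℂ, Continuous f → HasCompactSupport f → tsupport f ⊆ U → (∀ x, ‖f x‖ ≤ 1) →
      ‖cint κ.1 f‖ ≤ C) : κ.1.variation U ≤ ENNReal.ofReal C := by
  classical
  refine le_of_forall_lt fun a ha => ?_
  obtain ⟨P, hPU, hPd, hPm, haP⟩ := κ.1.exists_lt_sum_of_lt_variation hU.measurableSet ha
  refine haP.trans_le ?_
  have hsum : ∑ p ∈ P, ‖κ.1 p‖ₑ = ENNReal.ofReal (∑ p ∈ P, ‖κ.1 p‖) := by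
    rw [ENNReal.ofReal_sum_of_nonneg fun _ _ => norm_nonneg _]
    simp
  rw [hsum]
  refine ENNReal.ofReal_le_ofReal (le_of_forall_pos_le_add fun δ hδ => ?_)
  choose c hc1 hc2 using fun p => exists_norm_le_one_mul_eq_norm (κ.1 p)
  set q : G → ℂ := fun x => ∑ p ∈ P, p.indicator (fun _ => c p) x with hq
  have hqi1 (p) (hp : p ∈ P) : κ.1.Integrable (p.indicator fun _ => c p) :=
    MeasureTheory.Integrable.indicator (integrable_const _) (hPm p hp)
  have hqi : κ.1.Integrable q := integrable_finsetSum P hqi1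
  have hq1 (x) : ‖q x‖ ≤ 1 := by
    by_cases hx : ∃ p ∈ P, x ∈ p
    · obtain ⟨p, hp, hxp⟩ := hx
      have : q x = c p := by
        rw [hq]
        simp only
        rw [Finset.sum_eq_single p, Set.indicator_of_mem hxp]
        · intro r hr hrp
          exact Set.indicator_of_notMem
            (fun hxr => Set.disjoint_left.1 (hPd hr hp hrp) hxr hxp) _
        · exact fun h => absurd hp h
      rw [this]
      exact hc1 p
    · have : q x = 0 := Finset.sum_eq_zero fun p hp =>
        Set.indicator_of_notMem (fun hxp => hx ⟨p, hp, hxp⟩) _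
      simp [this]
  have hqU (x) (hx : x ∉ U) : q x = 0 := Finset.sum_eq_zero fun p hp =>
    Set.indicator_of_notMem (fun hxp => hx (hPU p hp hxp)) _
  have hqc : cint κ.1 q = ((∑ p ∈ P, ‖κ.1 p‖ : ℝ) : ℂ) := by
    rw [cint, hq, VectorMeasure.integral_finsetSum P hqi1]
    push_cast
    refine Finset.sum_congr rfl fun p hp => ?_
    rw [VectorMeasure.integral_indicator_const _ (hPm p hp), ← hc2 p]
    rfl
  set η : ℝ := δ / (4 * (P.card + 1)) with hη
  have hη0 : 0 < η := by positivity
  choose! φ hφs hφi using fun p (hp : p ∈ P) =>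
    exists_cc_indicator_integral_sub_le κ.1.variation (hPm p hp) hη0
  set g : G → ℂ := fun x => ∑ p ∈ P, c p * (φ p x : ℂ) with hgdef
  have hg : Continuous g := by fun_prop
  have hφint (p) (hp : p ∈ P) : MeasureTheory.Integrable (φ p) κ.1.variation :=
    integrable_of_cc (φ p).continuous (hφs p hp) _
  have hgint : κ.1.Integrable g :=
    integrable_finsetSum P fun p hp => (hφint p hp).ofReal.const_mul (c p)
  have hgi : ∫ x, ‖q x - g x‖ ∂κ.1.variation ≤ δ / 4 := by
    have hi (p) (hp : p ∈ P) :
        MeasureTheory.Integrable (fun x => |p.indicator 1 x - φ p x|) κ.1.variation :=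
      (((integrable_const (1 : ℝ)).indicator (hPm p hp)).sub (hφint p hp)).abs
    calc _ ≤ ∫ x, ∑ p ∈ P, |p.indicator 1 x - φ p x| ∂κ.1.variation := by
          refine integral_mono (MeasureTheory.Integrable.sub hqi hgint).norm
            (integrable_finsetSum P hi) fun x => ?_
          simp only [hq, hgdef, ← Finset.sum_sub_distrib]
          refine norm_sum_le_of_le P fun p hp => ?_
          have : p.indicator (fun _ => c p) x - c p * (φ p x : ℂ) =
              c p * ((p.indicator 1 x - φ p x : ℝ) : ℂ) := by
            by_cases hx : x ∈ p <;> simp [hx, mul_sub]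
          rw [this, norm_mul, Complex.norm_real]
          exact mul_le_of_le_one_left (norm_nonneg _) (hc1 p)
      _ = ∑ p ∈ P, ∫ x, |p.indicator 1 x - φ p x| ∂κ.1.variation := integral_finsetSum P hi
      _ ≤ ∑ _p ∈ P, η := Finset.sum_le_sum hφi
      _ ≤ δ / 4 := by
          rw [Finset.sum_const, nsmul_eq_mul, hη, mul_div_assoc', div_le_div_iff₀ (by positivity)
            (by positivity)]
          nlinarith
  obtain ⟨K, hKU, hK, hlt⟩ := hU.measurableSet.exists_isCompact_sdiff_lt
    (measure_ne_top κ.1.variation U) (ε := ENNReal.ofReal (δ / 2)) (by simpa using hδ)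
  obtain ⟨χ, hχ1, hχ2, hχ3, hχ4⟩ := exists_continuousMap_one_of_isCompact_subset_isOpen hK hU hKU
  have hχc : HasCompactSupport χ := hχ2
  have htc : Continuous fun x => unitTrunc (g x) := continuous_unitTrunc.comp hg
  have hχC : Continuous fun x => (χ x : ℂ) := by fun_prop
  set f : G → ℂ := fun x => (χ x : ℂ) * unitTrunc (g x) with hf
  have hfc : Continuous f := hχC.mul htc
  have hsub : tsupport f ⊆ tsupport χ := by
    refine closure_mono fun x hx hx0 => hx ?_
    simp [hf, hx0]
  have hfs : HasCompactSupport f := hχc.mono' ((subset_tsupport _).trans hsub)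
  have hχn (x) : ‖(χ x : ℂ)‖ ≤ 1 := by
    rw [Complex.norm_real, Real.norm_of_nonneg (hχ4 x).1]; exact (hχ4 x).2
  have hf1 (x) : ‖f x‖ ≤ 1 := by
    rw [hf, norm_mul]
    exact mul_le_one₀ (hχn x) (norm_nonneg _) (norm_unitTrunc_le _)
  have hfint : κ.1.Integrable f := integrable_of_continuous_of_bound κ hfc hf1
  have hpt (x) : ‖q x - f x‖ ≤ 2 * ‖q x - g x‖ + (U \ K).indicator (fun _ => (1 : ℝ)) x := by
    have h0 := norm_unitTrunc_sub_le (g x) (hq1 x)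
    rw [norm_sub_rev] at h0
    by_cases hxU : x ∈ U
    · by_cases hxK : x ∈ K
      · have : f x = unitTrunc (g x) := by
          have : χ x = 1 := hχ1 hxK
          simp [hf, this]
        rw [this, Set.indicator_of_notMem (fun h => h.2 hxK), add_zero]
        exact h0
      · rw [Set.indicator_of_mem (show x ∈ U \ K from ⟨hxU, hxK⟩)]
        have e : q x - f x = (q x - unitTrunc (g x)) + ((1 - χ x : ℝ) : ℂ) * unitTrunc (g x) := by
          simp only [hf]; push_cast; ring
        rw [e]
        refine (norm_add_le _ _).trans (add_le_add h0 ?_)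
        rw [norm_mul, Complex.norm_real, Real.norm_of_nonneg (by linarith [(hχ4 x).2])]
        exact mul_le_one₀ (by linarith [(hχ4 x).1]) (norm_nonneg _) (norm_unitTrunc_le _)
    · have : χ x = 0 := image_eq_zero_of_notMem_tsupport fun h => hxU (hχ3 h)
      have h1 : f x = 0 := by simp [hf, this]
      rw [h1, hqU x hxU, sub_self, norm_zero]
      exact add_nonneg (by positivity) (Set.indicator_nonneg (fun _ _ => zero_le_one) _)
  have hUK : MeasurableSet (U \ K) := hU.measurableSet.diff hK.measurableSet
  have hdiff : ‖cint κ.1 q - cint κ.1 f‖ ≤ δ := by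
    rw [← cint_sub κ.1 hqi hfint]
    refine (norm_cint_le_integral _ _).trans ?_
    have i1 : MeasureTheory.Integrable (fun x => 2 * ‖q x - g x‖) κ.1.variation :=
      ((MeasureTheory.Integrable.sub hqi hgint).norm).const_mul 2
    have i2 : MeasureTheory.Integrable ((U \ K).indicator fun _ => (1 : ℝ)) κ.1.variation :=
      (integrable_const _).indicator hUK
    calc _ ≤ ∫ x, (2 * ‖q x - g x‖ + (U \ K).indicator (fun _ => (1 : ℝ)) x) ∂κ.1.variation :=
          integral_mono (MeasureTheory.Integrable.sub hqi hfint).norm (i1.add i2) hpt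
      _ = 2 * (∫ x, ‖q x - g x‖ ∂κ.1.variation) + κ.1.variation.real (U \ K) := by
          rw [integral_add i1 i2, integral_const_mul, integral_indicator_const _ hUK]
          simp
      _ ≤ 2 * (δ / 4) + δ / 2 := by
          gcongr
          exact ENNReal.toReal_le_of_le_ofReal (by positivity) hlt.le
      _ = δ := by ring
  have h1 := h f hfc hfs (hsub.trans hχ3) hf1
  have h2 : ‖cint κ.1 q‖ = ∑ p ∈ P, ‖κ.1 p‖ := by
    rw [hqc, Complex.norm_real, Real.norm_of_nonneg (Finset.sum_nonneg fun _ _ => norm_nonneg _)]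
  have h3 := norm_sub_norm_le (cint κ.1 q) (cint κ.1 f)
  linarith

end Integral

section Vague

set_option linter.unusedSectionVars false

variable {G : Type*} [Group G] [TopologicalSpace G] [IsTopologicalGroup G] [LocallyCompactSpace G]
  [T2Space G] [MeasurableSpace G] [BorelSpace G]

theorem integrable_zeroAtInfty (κ : M G) (φ : C₀(G, ℂ)) : κ.1.Integrable φ :=
  integrable_of_continuous_of_bound κ (map_continuous φ) fun x => φ.toBCF.norm_coe_le_norm x

theorem integrable_hasCompactSupport (κ : M G) {φ : G → ℂ} (hφ : Continuous φ)
    (hc : HasCompactSupport φ) : κ.1.Integrable φ :=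
  integrable_of_cc hφ hc κ.1.variation

/-- Compactly supported functions are dense in `C₀(G)`. -/
theorem exists_cc_norm_sub_le (φ : C₀(G, ℂ)) {ε : ℝ} (hε : 0 < ε) :
    ∃ f : G → ℂ, Continuous f ∧ HasCompactSupport f ∧ ∀ x, ‖φ x - f x‖ ≤ ε := by
  have h := (Metric.tendsto_nhds.1 (zero_at_infty φ)) ε hε
  obtain ⟨K, hK, hKs⟩ := mem_cocompact.1 h
  obtain ⟨χ, h1, h2, -, h4⟩ := exists_continuousMap_one_of_isCompact_subset_isOpen hK isOpen_univ
    (Set.subset_univ K)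
  have h2' : HasCompactSupport χ := h2
  refine ⟨fun x => (χ x : ℂ) * φ x, by fun_prop, ?_, fun x => ?_⟩
  · exact (h2'.comp_left (g := Complex.ofReal) Complex.ofReal_zero).mul_right
  · by_cases hx : x ∈ K
    · have : χ x = 1 := h1 hx
      simp [this, hε.le]
    · have h5 : ‖φ x‖ < ε := by simpa using hKs hx
      have e : φ x - (χ x : ℂ) * φ x = ((1 - χ x : ℝ) : ℂ) * φ x := by push_cast; ring
      rw [e, norm_mul, Complex.norm_real, Real.norm_of_nonneg (by linarith [(h4 x).2])]
      exact (mul_le_of_le_one_left (norm_nonneg _) (by linarith [(h4 x).1])).trans h5.le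

/-- Integration against `κ`, as a functional on `C₀(G)`. -/
noncomputable def cintCLM (κ : M G) : C₀(G, ℂ) →L[ℂ] ℂ :=
  LinearMap.mkContinuous
    { toFun := fun φ => cint κ.1 φ
      map_add' := fun φ ψ => cint_add κ.1 (integrable_zeroAtInfty κ φ) (integrable_zeroAtInfty κ ψ)
      map_smul' := fun c φ => cint_const_mul κ (integrable_zeroAtInfty κ φ) c }
    (κ.1.variation.real Set.univ) fun φ => by
      rw [mul_comm]
      exact norm_cint_le κ.1 (ae_of_all _ fun x => φ.toBCF.norm_coe_le_norm x)

theorem variation_univ_le_norm_cintCLM (κ : M G) :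
    κ.1.variation Set.univ ≤ ENNReal.ofReal ‖cintCLM κ‖ := by
  refine variation_le_of_forall_norm_cint_le κ isOpen_univ fun f hf hc _ h1 => ?_
  let φ : C₀(G, ℂ) := ⟨⟨f, hf⟩, hc.is_zero_at_infty⟩
  refine ((cintCLM κ).le_opNorm φ).trans (mul_le_of_le_one_right (norm_nonneg _) ?_)
  rw [← ZeroAtInftyContinuousMap.norm_toBCF_eq_norm]
  exact (BoundedContinuousFunction.norm_le zero_le_one).2 h1

theorem exists_variation_le_of_vagueTendsto {ν : ℕ → M G} {κ : M G} (h : VagueTendsto ν κ) :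
    ∃ C : ℝ≥0, ∀ n, (ν n).1.variation Set.univ ≤ C := by
  obtain ⟨C, hC⟩ := banach_steinhaus (g := fun n => cintCLM (ν n)) fun φ => by
    obtain ⟨C, hC⟩ := (h φ).norm.bddAbove_range
    exact ⟨C, fun n => hC ⟨n, rfl⟩⟩
  exact ⟨C.toNNReal, fun n => (variation_univ_le_norm_cintCLM _).trans
    (ENNReal.ofReal_le_ofReal (hC n))⟩

theorem norm_cint_le_of_variation_le {κ : M G} {C : ℝ≥0} (hκ : κ.1.variation Set.univ ≤ C)
    {φ : G → ℂ} {D : ℝ} (hD : ∀ x, ‖φ x‖ ≤ D) : ‖cint κ.1 φ‖ ≤ D * C :=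
  (norm_cint_le κ.1 (ae_of_all _ hD)).trans
    (mul_le_mul_of_nonneg_left (ENNReal.toReal_mono ENNReal.coe_ne_top hκ)
      ((norm_nonneg _).trans (hD 1)))

theorem tendsto_cint_of_forall_approx {ι : Type*} {l : Filter ι} {ν : ι → M G} {κ : M G} {C : ℝ≥0}
    (hν : ∀ n, (ν n).1.variation Set.univ ≤ C) {φ : G → ℂ} (hφ : ∀ κ : M G, κ.1.Integrable φ)
    (h : ∀ ε > 0, ∃ f : G → ℂ, (∀ κ : M G, κ.1.Integrable f) ∧ (∀ x, ‖φ x - f x‖ ≤ ε) ∧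
      Tendsto (fun n => cint (ν n).1 f) l (𝓝 (cint κ.1 f))) :
    Tendsto (fun n => cint (ν n).1 φ) l (𝓝 (cint κ.1 φ)) := by
  refine Metric.tendsto_nhds.2 fun ε hε => ?_
  set D : ℝ := C + κ.1.variation.real Set.univ + 1 with hD
  have hD0 : 0 < D := by positivity
  obtain ⟨f, hf, hφf, hlim⟩ := h (ε / (2 * D)) (by positivity)
  filter_upwards [Metric.tendsto_nhds.1 hlim (ε / 2) (by positivity)] with n hn
  rw [dist_eq_norm] at hn ⊢
  have h1 : ‖cint (ν n).1 φ - cint (ν n).1 f‖ ≤ ε / (2 * D) * C := by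
    rw [← cint_sub _ (hφ _) (hf _)]
    exact norm_cint_le_of_variation_le (hν n) hφf
  have h2 : ‖cint κ.1 φ - cint κ.1 f‖ ≤ ε / (2 * D) * κ.1.variation.real Set.univ := by
    rw [← cint_sub _ (hφ _) (hf _)]
    exact norm_cint_le κ.1 (ae_of_all _ hφf)
  have e : cint (ν n).1 φ - cint κ.1 φ = (cint (ν n).1 φ - cint (ν n).1 f) +
      (cint (ν n).1 f - cint κ.1 f) - (cint κ.1 φ - cint κ.1 f) := by ring
  have h3 : ε / (2 * D) * C + ε / (2 * D) * κ.1.variation.real Set.univ + ε / (2 * D) = ε / 2 := by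
    rw [← mul_add, ← mul_add_one, ← hD]
    field_simp
  have h4 : 0 < ε / (2 * D) := by positivity
  rw [e]
  refine (norm_sub_le _ _).trans_lt ?_
  have := norm_add_le (cint (ν n).1 φ - cint (ν n).1 f) (cint (ν n).1 f - cint κ.1 f)
  linarith

/-- For bounded families of measures, vague convergence can be tested on `C_c(G)`. -/
theorem tendsto_cint_of_forall_cc {ι : Type*} {l : Filter ι} {ν : ι → M G} {κ : M G} {C : ℝ≥0}
    (hν : ∀ n, (ν n).1.variation Set.univ ≤ C)
    (h : ∀ f : G → ℂ, Continuous f → HasCompactSupport f →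
      Tendsto (fun n => cint (ν n).1 f) l (𝓝 (cint κ.1 f))) (φ : C₀(G, ℂ)) :
    Tendsto (fun n => cint (ν n).1 φ) l (𝓝 (cint κ.1 φ)) := by
  refine tendsto_cint_of_forall_approx hν (fun κ => integrable_zeroAtInfty κ φ) fun ε hε => ?_
  obtain ⟨f, hf, hc, hφf⟩ := exists_cc_norm_sub_le φ hε
  exact ⟨f, fun κ => integrable_hasCompactSupport κ hf hc, hφf, h f hf hc⟩

theorem inv_smul_convPowSucc (μ : M G) (n : ℕ) :
    ((n : ℂ) + 1)⁻¹ • convPowSucc μ n =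
      cesaro μ (n + 1) - ((n : ℂ) / (n + 1)) • cesaro μ n := by
  have h : (n : ℂ) + 1 ≠ 0 := by exact_mod_cast n.succ_ne_zero
  rw [cesaro, cesaro, Finset.sum_range_succ, smul_add, smul_smul]
  rcases eq_or_ne n 0 with rfl | hn
  · simp only [Finset.range_zero, Finset.sum_empty, smul_zero, zero_add, Nat.cast_zero,
      Nat.cast_one, zero_div]
    exact (sub_zero (_ : M G)).symm
  · have hn' : (n : ℂ) ≠ 0 := by exact_mod_cast hn
    rw [div_mul_eq_mul_div, mul_inv_cancel₀ hn']
    push_cast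
    rw [one_div]
    exact (add_sub_cancel_left (_ : M G) _).symm

theorem tendsto_natCast_div_add_one : Tendsto (fun n : ℕ => (n : ℂ) / (n + 1)) atTop (𝓝 1) :=
  tendsto_natCast_div_add_atTop 1

theorem CesaroBounded.exists_variation_inv_smul_le {μ : M G} (h : CesaroBounded μ) :
    ∃ C : ℝ≥0, ∀ n : ℕ, (((n : ℂ) + 1)⁻¹ • convPowSucc μ n).1.variation Set.univ ≤ C := by
  obtain ⟨C, hC⟩ := h
  refine ⟨C + C, fun n => ?_⟩
  rw [inv_smul_convPowSucc]
  have h1 : (cesaro μ (n + 1) - ((n : ℂ) / (n + 1)) • cesaro μ n).1.variation ≤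
      (cesaro μ (n + 1)).1.variation + (((n : ℂ) / (n + 1)) • (cesaro μ n).1).variation :=
    VectorMeasure.variation_sub_le
  refine (h1 _).trans ?_
  rw [Measure.add_apply, VectorMeasure.variation_smul, ENNReal.coe_add]
  refine add_le_add (hC _) ?_
  refine le_trans ?_ (hC n)
  have h2 : ‖(n : ℂ) / (n + 1)‖₊ ≤ 1 := by
    have : ‖(n : ℂ) + 1‖ = (n : ℝ) + 1 := by
      exact_mod_cast Complex.norm_natCast (n + 1)
    rw [← NNReal.coe_le_coe, coe_nnnorm, norm_div, this, Complex.norm_natCast]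
    exact div_le_one_of_le₀ (by linarith) (by positivity)
  calc _ ≤ (1 : ℝ≥0∞) * (cesaro μ n).1.variation Set.univ := by
        rw [Measure.smul_apply]
        exact mul_le_mul_left (by exact_mod_cast h2) _
    _ = _ := one_mul _

open CompactlySupported in
/-- Vague compactness of bounded sequences of positive measures. -/
theorem exists_tendsto_integral_ultrafilter (𝒰 : Ultrafilter ℕ) (v : ℕ → Measure G)
    [∀ n, IsFiniteMeasure (v n)] {C : ℝ≥0} (hC : ∀ n, v n Set.univ ≤ C) :
    ∃ r : Measure G, IsFiniteMeasure r ∧ r.Regular ∧ ∀ f : G → ℂ, Continuous f →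
      HasCompactSupport f → Tendsto (fun n => ∫ x, f x ∂(v n)) 𝒰 (𝓝 (∫ x, f x ∂r)) := by
  have hv (n) : (v n).real Set.univ ≤ C := ENNReal.toReal_mono ENNReal.coe_ne_top (hC n)
  have hb (f : C_c(G, ℝ)) : ∃ a : ℝ, Tendsto (fun n => ∫ x, f x ∂(v n)) 𝒰 (𝓝 a) := by
    obtain ⟨D, hD⟩ := (map_continuous f).bounded_above_of_compact_support f.hasCompactSupport
    have hm : ∀ n, ∫ x, f x ∂(v n) ∈ Metric.closedBall (0 : ℝ) (D * C) := fun n => by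
      rw [mem_closedBall_zero_iff]
      exact (norm_integral_le_of_norm_le_const (ae_of_all _ hD)).trans
        (mul_le_mul_of_nonneg_left (hv n) ((norm_nonneg _).trans (hD 1)))
    obtain ⟨a, -, ha⟩ := (isCompact_closedBall (0 : ℝ) (D * C)).ultrafilter_le_nhds
      (𝒰.map fun n => ∫ x, f x ∂(v n)) (le_principal_iff.2 (mem_map.2 (Eventually.of_forall hm)))
    exact ⟨a, ha⟩
  choose L hL using hb
  have hi (f : C_c(G, ℝ)) (n) : Integrable f (v n) :=
    integrable_of_cc (map_continuous f) f.hasCompactSupport _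
  let Λ : C_c(G, ℝ) →ₚ[ℝ] ℝ := PositiveLinearMap.mk₀
    { toFun := L
      map_add' := by
        intro f g
        refine tendsto_nhds_unique (hL _) (((hL f).add (hL g)).congr fun n => ?_)
        rw [← integral_add (hi f n) (hi g n)]
        rfl
      map_smul' := by
        intro c f
        refine tendsto_nhds_unique (hL _) (((hL f).const_mul c).congr fun n => ?_)
        simp [integral_const_mul] }
    (fun f hf => ge_of_tendsto' (hL f) fun n => integral_nonneg hf)
  have hΛ (f : C_c(G, ℝ)) : Tendsto (fun n => ∫ x, f x ∂(v n)) 𝒰 (𝓝 (Λ f)) := hL f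
  have key (f : G → ℝ) (hf : Continuous f) (hc : HasCompactSupport f) :
      Tendsto (fun n => ∫ x, f x ∂(v n)) 𝒰 (𝓝 (∫ z, f z ∂(RealRMK.rieszMeasure Λ))) := by
    have := RealRMK.integral_rieszMeasure Λ ⟨⟨f, hf⟩, hc⟩
    have h2 := hΛ ⟨⟨f, hf⟩, hc⟩
    rw [← this] at h2
    exact h2
  refine ⟨RealRMK.rieszMeasure Λ, ⟨?_⟩, inferInstance, ?_⟩
  · rw [isOpen_univ.measure_eq_iSup_isCompact]
    refine (iSup₂_le fun K _ => iSup_le fun hK => ?_ : _ ≤ ENNReal.ofReal C).trans_lt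
      ENNReal.ofReal_lt_top
    obtain ⟨φ, h1, h2, -, h3⟩ := exists_continuousMap_one_of_isCompact_subset_isOpen hK isOpen_univ
      (Set.subset_univ K)
    refine (RealRMK.rieszMeasure_le_of_eq_one Λ (f := ⟨φ, h2⟩) (fun x => (h3 x).1) hK
      (fun x hx => h1 hx)).trans ?_
    refine ENNReal.ofReal_le_ofReal (le_of_tendsto' (hΛ _) fun n => ?_)
    calc _ ≤ ∫ x, (1 : ℝ) ∂(v n) := integral_mono (hi _ n) (integrable_const _) (fun x => (h3 _).2)
      _ = (v n).real Set.univ := by simp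
      _ ≤ C := hv n
  · intro f hf hc
    have hre := key (fun z => (f z).re) (Complex.continuous_re.comp hf)
      (hc.comp_left (g := Complex.re) Complex.zero_re)
    have him := key (fun z => (f z).im) (Complex.continuous_im.comp hf)
      (hc.comp_left (g := Complex.im) Complex.zero_im)
    have hsplit (w : Measure G) (hw : Integrable f w) :
        ∫ x, f x ∂w = ((∫ x, (f x).re ∂w : ℝ) : ℂ) + ((∫ x, (f x).im ∂w : ℝ) : ℂ) * Complex.I :=
      (integral_re_add_im hw).symm
    have hfin : IsFiniteMeasureOnCompacts (RealRMK.rieszMeasure Λ) := inferInstance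
    rw [hsplit _ (hf.integrable_of_hasCompactSupport hc)]
    refine Tendsto.congr (fun n => (hsplit (v n) (integrable_of_cc hf hc _)).symm) ?_
    exact ((Complex.continuous_ofReal.tendsto _).comp hre).add
      (((Complex.continuous_ofReal.tendsto _).comp him).mul_const _)

/-- Vague compactness of bounded sequences in `M(G)`. -/
theorem exists_tendsto_cint_ultrafilter (𝒰 : Ultrafilter ℕ) {ν : ℕ → M G} {C : ℝ≥0}
    (hν : ∀ n, (ν n).1.variation Set.univ ≤ C) :
    ∃ κ : M G, ∀ φ : C₀(G, ℂ), Tendsto (fun n => cint (ν n).1 φ) 𝒰 (𝓝 (cint κ.1 φ)) := by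
  choose ρ h1 h2 h3 h4 using fun n => exists_decomp (ν n)
  choose r hr1 hr2 hr using fun k : Fin 4 =>
    exists_tendsto_integral_ultrafilter 𝒰 (fun n => ρ n k) (C := C)
      fun n => (h3 n k Set.univ).trans (hν n)
  obtain ⟨κ, hκ⟩ := exists_comb coef r
  refine ⟨κ, tendsto_cint_of_forall_cc hν fun f hf hc => ?_⟩
  rw [cint_eq_sum κ.1 _ r hκ fun k => integrable_of_cc hf hc _]
  refine Tendsto.congr (fun n =>
    (cint_eq_sum (ν n).1 _ (ρ n) (h4 n) fun k => integrable_of_cc hf hc _).symm) ?_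
  exact tendsto_finsetSum _ fun k _ => (hr k f hf hc).const_mul _

end Vague

section ConvOp

set_option linter.unusedSectionVars false

variable {G : Type*} [Group G] [TopologicalSpace G] [IsTopologicalGroup G] [LocallyCompactSpace G]
  [T2Space G] [MeasurableSpace G] [BorelSpace G]

theorem continuous_cint_translate (μ : M G) {f : G → ℂ} (hf : Continuous f)
    (hc : HasCompactSupport f) : Continuous fun y => cint μ.1 fun x => f (x * y) := by
  obtain ⟨ρ, h1, h2, h3, h4⟩ := exists_decomp μ
  have e (y : G) : (cint μ.1 fun x => f (x * y)) = ∑ i, coef i * ∫ x, f (x * y) ∂(ρ i) :=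
    cint_eq_sum μ.1 _ ρ h4 fun p => integrable_translate hf hc _ y
  simp_rw [e]
  exact continuous_finsetSum _ fun i _ => continuous_const.mul (continuous_inner hf hc (ρ i))

open scoped Pointwise in
/-- The defining formula of the convolution extends to bounded continuous functions. -/
theorem cint_conv_of_bound (μ ν : M G) {φ : G → ℂ} (hφ : Continuous φ) {C : ℝ}
    (hC : ∀ x, ‖φ x‖ ≤ C) :
    cint (conv μ ν).1 φ = cint ν.1 fun y => cint μ.1 fun x => φ (x * y) := by
  obtain ⟨A, hA, hAae⟩ := exists_sigmaCompact_conull μ.1.variation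
  obtain ⟨B, hB, hBae⟩ := exists_sigmaCompact_conull ν.1.variation
  obtain ⟨D, hD, hDae⟩ := exists_sigmaCompact_conull (conv μ ν).1.variation
  have hK (n : ℕ) : IsCompact (Set.accumulate A n * Set.accumulate B n ∪ Set.accumulate D n) :=
    ((isCompact_accumulate hA n).mul (isCompact_accumulate hB n)).union (isCompact_accumulate hD n)
  choose χ h1 h2 _ h4 using fun n => exists_continuousMap_one_of_isCompact_subset_isOpen (hK n)
    isOpen_univ (Set.subset_univ _)
  have hχc (n) : HasCompactSupport (χ n) := h2 n
  have hev {E : ℕ → Set G} {x : G} (hx : x ∈ ⋃ n, E n) :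
      ∀ᶠ n in atTop, x ∈ Set.accumulate E n := by
    obtain ⟨k, hk⟩ := Set.mem_iUnion.1 hx
    filter_upwards [eventually_ge_atTop k] with n hn
    exact Set.mem_biUnion (x := k) hn hk
  let F (n : ℕ) (x : G) : ℂ := (χ n x : ℂ) * φ x
  have hFc (n) : Continuous (F n) := by
    have := (χ n).continuous
    fun_prop
  have hFs (n) : HasCompactSupport (F n) :=
    ((hχc n).comp_left (g := Complex.ofReal) Complex.ofReal_zero).mul_right
  have hFb (n x) : ‖F n x‖ ≤ C := by
    rw [norm_mul, Complex.norm_real, Real.norm_of_nonneg (h4 n x).1]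
    exact (mul_le_of_le_one_left (norm_nonneg _) (h4 n x).2).trans (hC x)
  have hF1 {n x} (hx : x ∈ Set.accumulate A n * Set.accumulate B n ∪ Set.accumulate D n) :
      F n x = φ x := by
    have : χ n x = 1 := h1 n hx
    simp [F, this]
  have hlim1 : Tendsto (fun n => cint (conv μ ν).1 (F n)) atTop (𝓝 (cint (conv μ ν).1 φ)) := by
    refine VectorMeasure.tendsto_integral_of_dominated_convergence (fun _ => C)
      (fun n => aesm_of_continuous (hFc n) _) (integrable_const _) (fun n => ae_of_all _ (hFb n)) ?_
    filter_upwards [hDae] with x hx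
    refine tendsto_const_nhds.congr' ?_
    filter_upwards [hev hx] with n hn using (hF1 (Or.inr hn)).symm
  have hlim2 : Tendsto (fun n => cint ν.1 fun y => cint μ.1 fun x => F n (x * y)) atTop
      (𝓝 (cint ν.1 fun y => cint μ.1 fun x => φ (x * y))) := by
    refine VectorMeasure.tendsto_integral_of_dominated_convergence
      (fun _ => C * μ.1.variation.real Set.univ)
      (fun n => aesm_of_continuous (continuous_cint_translate μ (hFc n) (hFs n)) _)
      (integrable_const _)
      (fun n => ae_of_all _ fun y => norm_cint_le _ (ae_of_all _ fun x => hFb n _)) ?_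
    filter_upwards [hBae] with y hy
    refine VectorMeasure.tendsto_integral_of_dominated_convergence (fun _ => C)
      (fun n => aesm_of_continuous ((hFc n).comp (continuous_mul_const y)) _)
      (integrable_const _) (fun n => ae_of_all _ fun x => hFb n _) ?_
    filter_upwards [hAae] with x hx
    refine tendsto_const_nhds.congr' ?_
    filter_upwards [hev hx, hev hy] with n hn hn'
    exact (hF1 (Or.inl (Set.mul_mem_mul hn hn'))).symm
  refine tendsto_nhds_unique hlim1 (hlim2.congr fun n => ?_)
  exact (cint_conv μ ν (hFc n) (hFs n)).symm

variable (m : Measure G) [m.IsHaarMeasure] [m.Regular] {p : ℝ≥0∞} [Fact (1 ≤ p)]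

theorem translate_translate (x y : G) (f : Lp ℂ p m) :
    translate m x (translate m y f) = translate m (x * y) f := by
  rw [translate, translate, translate, smul_smul]
  congr 1
  rw [mul_inv_rev]
  rfl

theorem continuous_dual_translate (hp : p ≠ ∞) (ℓ : StrongDual ℂ (Lp ℂ p m)) (f : Lp ℂ p m) :
    Continuous fun x => ℓ (translate m x f) :=
  ℓ.continuous.comp (continuous_translate m hp f)

theorem norm_dual_translate_le (ℓ : StrongDual ℂ (Lp ℂ p m)) (f : Lp ℂ p m) (x : G) :
    ‖ℓ (translate m x f)‖ ≤ ‖ℓ‖ * ‖f‖ :=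
  (ℓ.le_opNorm _).trans_eq (by rw [norm_translate])

theorem integrable_dual_translate (hp : p ≠ ∞) (κ : M G) (ℓ : StrongDual ℂ (Lp ℂ p m))
    (f : Lp ℂ p m) : κ.1.Integrable fun x => ℓ (translate m x f) :=
  integrable_of_continuous_of_bound κ (continuous_dual_translate m hp ℓ f)
    (norm_dual_translate_le m ℓ f)

theorem convOp_eq_sum (hp : p ≠ ∞) (μ : M G) (ρ : Fin 4 → Measure G) [∀ k, IsFiniteMeasure (ρ k)]
    [∀ k, (ρ k).Regular] (h : ∀ s, MeasurableSet s → μ.1 s = ∑ k, coef k * ((ρ k).real s : ℂ))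
    (f : Lp ℂ p m) : convOp m hp μ f = ∑ k, coef k • posOp m hp (ρ k) f := by
  refine Lp.ext ((convOp_ae m hp μ f).trans ?_)
  have ha : ∀ᵐ s ∂m, ∀ k, Integrable (fun x => f (x⁻¹ * s)) (ρ k) ∧
      posOp m hp (ρ k) f s = ∫ x, f (x⁻¹ * s) ∂(ρ k) :=
    ae_all_iff.2 fun k => posOp_ae m hp (ρ k) f
  have hb : ∀ᵐ s ∂m, ∀ k, (coef k • posOp m hp (ρ k) f : Lp ℂ p m) s =
      coef k * posOp m hp (ρ k) f s := ae_all_iff.2 fun k => by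
    filter_upwards [Lp.coeFn_smul (coef k) (posOp m hp (ρ k) f)] with s hs
    rw [hs, Pi.smul_apply, smul_eq_mul]
  filter_upwards [ha, hb, Lp.coeFn_finsetSum Finset.univ fun k => coef k • posOp m hp (ρ k) f]
    with s h5 h6 h7
  rw [cint_eq_sum μ.1 _ ρ h fun k => (h5 k).1, h7, Finset.sum_apply]
  exact Finset.sum_congr rfl fun k _ => by rw [h6 k, (h5 k).2]

/-- The convolution operator is the weak integral of the translations. -/
theorem dual_convOp (hp : p ≠ ∞) (μ : M G) (ℓ : StrongDual ℂ (Lp ℂ p m)) (f : Lp ℂ p m) :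
    ℓ (convOp m hp μ f) = cint μ.1 fun x => ℓ (translate m x f) := by
  obtain ⟨ρ, h1, h2, h3, h4⟩ := exists_decomp μ
  rw [convOp_eq_sum m hp μ ρ h4, cint_eq_sum μ.1 _ ρ h4 fun k =>
    ℓ.integrable_comp (integrable_translateLp m hp f (ρ k)), map_sum]
  refine Finset.sum_congr rfl fun k _ => ?_
  rw [map_smul, smul_eq_mul, posOp_apply,
    ← ContinuousLinearMap.integral_comp_comm _ (integrable_translateLp m hp f _)]

theorem ext_of_forall_dual {f g : Lp ℂ p m} (h : ∀ ℓ : StrongDual ℂ (Lp ℂ p m), ℓ f = ℓ g) :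
    f = g :=
  (SeparatingDual.eq_iff_forall_dual_eq (R := ℂ)).2 h

theorem convOp_smul (hp : p ≠ ∞) (c : ℂ) (μ : M G) :
    convOp m hp (c • μ) = c • convOp m hp μ := by
  ext1 f
  refine ext_of_forall_dual m fun ℓ => ?_
  rw [_root_.smul_apply, map_smul, dual_convOp, dual_convOp,
    cint_smul_measure _ (integrable_dual_translate m hp _ ℓ f), smul_eq_mul]

theorem convOp_sub (hp : p ≠ ∞) (μ ν : M G) :
    convOp m hp (μ - ν) = convOp m hp μ - convOp m hp ν := by
  ext1 f
  refine ext_of_forall_dual m fun ℓ => ?_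
  rw [_root_.sub_apply, map_sub, dual_convOp, dual_convOp, dual_convOp]
  exact VectorMeasure.integral_sub_vectorMeasure (integrable_dual_translate m hp μ ℓ f)
    (integrable_dual_translate m hp ν ℓ f)

theorem convOp_sum (hp : p ≠ ∞) {ι : Type*} (s : Finset ι) (μ : ι → M G) :
    convOp m hp (∑ i ∈ s, μ i) = ∑ i ∈ s, convOp m hp (μ i) := by
  ext1 f
  refine ext_of_forall_dual m fun ℓ => ?_
  rw [_root_.sum_apply, map_sum, dual_convOp,
    cint_sum_measure s _ fun i => integrable_dual_translate m hp _ ℓ f]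
  exact Finset.sum_congr rfl fun i _ => (dual_convOp m hp _ ℓ f).symm

theorem convOp_conv (hp : p ≠ ∞) (μ ν : M G) :
    convOp m hp (conv μ ν) = convOp m hp μ * convOp m hp ν := by
  ext1 f
  refine ext_of_forall_dual m fun ℓ => ?_
  rw [dual_convOp, cint_conv_of_bound μ ν (continuous_dual_translate m hp ℓ f)
    (norm_dual_translate_le m ℓ f)]
  have h := dual_convOp m hp ν (ℓ.comp (convOp m hp μ)) f
  refine Eq.trans ?_ h.symm
  congr 1 with y
  rw [ContinuousLinearMap.comp_apply, dual_convOp]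
  simp_rw [translate_translate]

theorem convOp_convPowSucc (hp : p ≠ ∞) (μ : M G) (n : ℕ) :
    convOp m hp (convPowSucc μ n) = convOp m hp μ ^ (n + 1) := by
  induction n with
  | zero => rw [zero_add, pow_one]; rfl
  | succ n ih => rw [convPowSucc, convOp_conv, ih, ← pow_succ]

theorem opCesaro_convOp (hp : p ≠ ∞) (μ : M G) (n : ℕ) :
    opCesaro (convOp m hp μ) n = convOp m hp (cesaro μ n) := by
  rw [opCesaro, cesaro, convOp_smul, convOp_sum]
  simp_rw [convOp_convPowSucc]

end ConvOp

section Coefficients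

set_option linter.unusedSectionVars false

variable {G : Type*} [Group G] [TopologicalSpace G] [IsTopologicalGroup G] [LocallyCompactSpace G]
  [T2Space G] [MeasurableSpace G] [BorelSpace G]
  (m : Measure G) [m.IsHaarMeasure] [m.Regular] {p : ℝ≥0∞} [Fact (1 ≤ p)]

theorem translate_toLp_ae {f : G → ℂ} (hm : MemLp f p m) (x : G) :
    translate m x (hm.toLp f) =ᵐ[m] fun t => f (x⁻¹ * t) := by
  have h : ∀ᵐ t ∂m, (hm.toLp f) (x⁻¹ * t) = f (x⁻¹ * t) :=
    (measurePreserving_mul_left m x⁻¹).quasiMeasurePreserving.ae hm.coeFn_toLp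
  filter_upwards [translate_ae m x (hm.toLp f), h] with t h1 h2
  rw [h1, h2]

/-- The norm of a combination of disjoint translates of a function. -/
theorem enorm_sum_translate_rpow_le (hp : p ≠ ∞) {f : G → ℂ} (hf : Continuous f)
    (hm : MemLp f p m) (s : Finset G)
    (hs : ∀ t, ∀ x ∈ s, ∀ y ∈ s, f (x⁻¹ * t) ≠ 0 → f (y⁻¹ * t) ≠ 0 → x = y)
    {c : G → ℂ} (hc : ∀ x, ‖c x‖ ≤ 1) :
    ‖∑ x ∈ s, c x • translate m x (hm.toLp f)‖ₑ ^ p.toReal ≤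
      s.card * ‖hm.toLp f‖ₑ ^ p.toReal := by
  have hp0 : p ≠ 0 := (zero_lt_one.trans_le (Fact.out : 1 ≤ p)).ne'
  have hr : 0 < p.toReal := ENNReal.toReal_pos hp0 hp
  have hnorm (F : Lp ℂ p m) : ‖F‖ₑ ^ p.toReal = ∫⁻ t, ‖F t‖ₑ ^ p.toReal ∂m := by
    rw [Lp.enorm_def, eLpNorm_eq_lintegral_rpow_enorm_toReal hp0 hp, ← ENNReal.rpow_mul, one_div,
      inv_mul_cancel₀ hr.ne', ENNReal.rpow_one]
  have hsum : ∀ᵐ t ∂m, (∑ x ∈ s, c x • translate m x (hm.toLp f) : Lp ℂ p m) t =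
      ∑ x ∈ s, c x * f (x⁻¹ * t) := by
    have h1 : ∀ᵐ t ∂m, ∀ x ∈ s, (c x • translate m x (hm.toLp f) : Lp ℂ p m) t =
        c x * f (x⁻¹ * t) := (Finset.eventually_all s).2 fun x _ => by
      filter_upwards [Lp.coeFn_smul (c x) (translate m x (hm.toLp f)),
        translate_toLp_ae m hm x] with t h1 h2
      rw [h1, Pi.smul_apply, h2, smul_eq_mul]
    filter_upwards [h1, Lp.coeFn_finsetSum s fun x => c x • translate m x (hm.toLp f)]
      with t h2 h3
    rw [h3, Finset.sum_apply]
    exact Finset.sum_congr rfl h2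
  have hf0 : ∫⁻ t, ‖(hm.toLp f) t‖ₑ ^ p.toReal ∂m = ∫⁻ t, ‖f t‖ₑ ^ p.toReal ∂m :=
    lintegral_congr_ae (hm.coeFn_toLp.fun_comp fun z => ‖z‖ₑ ^ p.toReal)
  rw [hnorm, hnorm, hf0]
  calc _ ≤ ∫⁻ t, ∑ x ∈ s, ‖f (x⁻¹ * t)‖ₑ ^ p.toReal ∂m := by
        refine lintegral_mono_ae ?_
        filter_upwards [hsum] with t ht
        rw [ht]
        by_cases h : ∃ x ∈ s, f (x⁻¹ * t) ≠ 0
        · obtain ⟨x, hx, hxt⟩ := h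
          rw [Finset.sum_eq_single_of_mem x hx]
          · refine le_trans ?_ (Finset.single_le_sum (f := fun x => ‖f (x⁻¹ * t)‖ₑ ^ p.toReal)
              (fun _ _ => zero_le) hx)
            refine ENNReal.rpow_le_rpow ?_ hr.le
            rw [enorm_mul]
            refine mul_le_of_le_one_left zero_le ?_
            rw [← ofReal_norm]
            exact ENNReal.ofReal_le_one.2 (hc x)
          · intro y hy hyx
            have : f (y⁻¹ * t) = 0 := by
              by_contra h0
              exact hyx (hs t y hy x hx h0 hxt)
            rw [this, mul_zero]
        · push Not at h
          rw [Finset.sum_eq_zero fun x hx => by rw [h x hx, mul_zero]]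
          simp [ENNReal.zero_rpow_of_pos hr]
    _ = ∑ x ∈ s, ∫⁻ t, ‖f (x⁻¹ * t)‖ₑ ^ p.toReal ∂m := by
        refine lintegral_finsetSum s fun x _ => ?_
        have : Continuous fun t => f (x⁻¹ * t) := by fun_prop
        exact this.enorm.measurable.pow_const _
    _ = ∑ _x ∈ s, ∫⁻ t, ‖f t‖ₑ ^ p.toReal ∂m := Finset.sum_congr rfl fun x _ =>
        lintegral_mul_left_eq_self (fun t => ‖f t‖ₑ ^ p.toReal) x⁻¹
    _ = _ := by rw [Finset.sum_const, nsmul_eq_mul]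

open scoped Pointwise in
/-- A set which is not relatively compact contains arbitrarily many points with disjoint translates
of a given compact set. -/
theorem exists_finset_disjoint_translates {S K : Set G} (hK : IsCompact K)
    (hS : ∀ L : Set G, IsCompact L → ∃ x ∈ S, x ∉ L) (N : ℕ) :
    ∃ s : Finset G, s.card = N ∧ (∀ x ∈ s, x ∈ S) ∧
      ∀ t, ∀ x ∈ s, ∀ y ∈ s, x⁻¹ * t ∈ K → y⁻¹ * t ∈ K → x = y := by
  classical
  induction N with
  | zero => exact ⟨∅, by simp⟩
  | succ N ih =>
    obtain ⟨s, hcard, hsS, hs⟩ := ih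
    obtain ⟨z, hzS, hz⟩ := hS (s * K * K⁻¹) ((s.finite_toSet.isCompact.mul hK).mul hK.inv)
    have key {t x : G} (hx : x ∈ s) (hxt : x⁻¹ * t ∈ K) (hzt : z⁻¹ * t ∈ K) : False := by
      refine hz ?_
      have : z = x * (x⁻¹ * t) * (z⁻¹ * t)⁻¹ := by group
      rw [this]
      exact Set.mul_mem_mul (Set.mul_mem_mul hx hxt) (Set.inv_mem_inv.2 hzt)
    obtain hzs | ⟨k, hk⟩ := K.eq_empty_or_nonempty
    · obtain ⟨z, hzS, hz⟩ := hS s s.finite_toSet.isCompact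
      refine ⟨insert z s, by rw [Finset.card_insert_of_notMem (by simpa using hz), hcard], ?_, ?_⟩
      · simpa [hzS] using hsS
      · simp [hzs]
    have hzs : z ∉ s := fun h => key (t := z * k) h (by simpa using hk) (by simpa using hk)
    refine ⟨insert z s, by rw [Finset.card_insert_of_notMem hzs, hcard], ?_, ?_⟩
    · simpa [hzS] using hsS
    · intro t x hx y hy hxt hyt
      rcases Finset.mem_insert.1 hx with hx' | hx' <;>
        rcases Finset.mem_insert.1 hy with hy' | hy'
      · rw [hx', hy']
      · exact (key hy' hyt (hx' ▸ hxt)).elim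
      · exact (key hx' hxt (hy' ▸ hyt)).elim
      · exact hs t x hx' y hy' hxt hyt

theorem tendsto_dual_translate_cocompact_of_cc (hp : p ≠ ∞) (hp1 : 1 < p) {f : G → ℂ}
    (hf : Continuous f) (hc : HasCompactSupport f) (hm : MemLp f p m)
    (ℓ : StrongDual ℂ (Lp ℂ p m)) :
    Tendsto (fun x => ℓ (translate m x (hm.toLp f))) (cocompact G) (𝓝 0) := by
  refine Metric.tendsto_nhds.2 fun ε hε => ?_
  by_contra hcon
  have hS (L : Set G) (hL : IsCompact L) :
      ∃ x ∈ {x | ε ≤ ‖ℓ (translate m x (hm.toLp f))‖}, x ∉ L := by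
    by_contra h
    push Not at h
    refine hcon (mem_cocompact.2 ⟨L, hL, fun x hx => ?_⟩)
    by_contra h2
    exact hx (h x (by simpa using h2))
  have hp0 : p ≠ 0 := (zero_lt_one.trans hp1).ne'
  have hr : 0 < p.toReal := ENNReal.toReal_pos hp0 hp
  have hr1 : 1 < p.toReal := by
    rw [← ENNReal.toReal_one]
    exact (ENNReal.toReal_lt_toReal ENNReal.one_ne_top hp).2 hp1
  set r := p.toReal with hrdef
  choose c hc1 hc2 using fun x => exists_norm_le_one_mul_eq_norm (ℓ (translate m x (hm.toLp f)))
  have key (N : ℕ) (hN : 0 < N) : (N : ℝ) ^ (r - 1) ≤ (‖ℓ‖ * ‖hm.toLp f‖ / ε) ^ r := by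
    obtain ⟨s, hcard, hsS, hs⟩ := exists_finset_disjoint_translates hc hS N
    set F := ∑ x ∈ s, c x • translate m x (hm.toLp f) with hF
    have h1 : ‖F‖ ^ r ≤ N * ‖hm.toLp f‖ ^ r := by
      have h := enorm_sum_translate_rpow_le m hp hf hm s
        (fun t x hx y hy h1 h2 => hs t x hx y hy (subset_tsupport f h1) (subset_tsupport f h2)) hc1
      have h' := ENNReal.toReal_mono (by finiteness) h
      rwa [← ENNReal.toReal_rpow, ENNReal.toReal_mul, ← ENNReal.toReal_rpow, toReal_enorm,
        toReal_enorm, ENNReal.toReal_natCast, hcard] at h'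
    have h2 : N * ε ≤ ‖ℓ‖ * ‖F‖ := by
      have h3 : ℓ F = ((∑ x ∈ s, ‖ℓ (translate m x (hm.toLp f))‖ : ℝ) : ℂ) := by
        rw [hF, map_sum]
        push_cast
        exact Finset.sum_congr rfl fun x _ => by rw [map_smul, smul_eq_mul, hc2]
      calc (N : ℝ) * ε = ∑ _x ∈ s, ε := by rw [Finset.sum_const, hcard, nsmul_eq_mul]
        _ ≤ ∑ x ∈ s, ‖ℓ (translate m x (hm.toLp f))‖ := Finset.sum_le_sum hsS
        _ = ‖ℓ F‖ := by
          rw [h3, Complex.norm_real, Real.norm_of_nonneg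
            (Finset.sum_nonneg fun _ _ => norm_nonneg _)]
        _ ≤ _ := ℓ.le_opNorm F
    have hN' : (0 : ℝ) < N := by exact_mod_cast hN
    have h4 : (N * ε) ^ r ≤ N * (‖ℓ‖ * ‖hm.toLp f‖) ^ r := by
      calc _ ≤ (‖ℓ‖ * ‖F‖) ^ r := Real.rpow_le_rpow (by positivity) h2 hr.le
        _ = ‖ℓ‖ ^ r * ‖F‖ ^ r := Real.mul_rpow (norm_nonneg _) (norm_nonneg _)
        _ ≤ ‖ℓ‖ ^ r * (N * ‖hm.toLp f‖ ^ r) := by gcongr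
        _ = _ := by rw [Real.mul_rpow (norm_nonneg _) (norm_nonneg _)]; ring
    rw [Real.mul_rpow hN'.le hε.le] at h4
    rw [Real.div_rpow (by positivity) hε.le, le_div_iff₀ (by positivity), Real.rpow_sub_one hN'.ne',
      div_mul_eq_mul_div, div_le_iff₀ hN', mul_comm _ (N : ℝ)]
    exact h4
  have hlim : Tendsto (fun N : ℕ => (N : ℝ) ^ (r - 1)) atTop atTop :=
    (tendsto_rpow_atTop (sub_pos.2 hr1)).comp tendsto_natCast_atTop_atTop
  obtain ⟨N, hN1, hN2⟩ := ((hlim.eventually_gt_atTop ((‖ℓ‖ * ‖hm.toLp f‖ / ε) ^ r)).and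
    (eventually_gt_atTop 0)).exists
  exact absurd (key N hN2) (not_le.2 hN1)

theorem exists_cc_norm_toLp_sub_le (hp : p ≠ ∞) (f : Lp ℂ p m) {ε : ℝ} (hε : 0 < ε) :
    ∃ (g : G → ℂ) (hm : MemLp g p m), Continuous g ∧ HasCompactSupport g ∧
      ‖f - hm.toLp g‖ ≤ ε := by
  obtain ⟨g, hc, hfg, hg, hm⟩ := exists_cc_approx m hp (Lp.memLp f) (ε := ENNReal.ofReal ε)
    (by simpa using hε)
  refine ⟨g, hm, hg, hc, ?_⟩
  rw [← ENNReal.ofReal_le_ofReal_iff hε.le, ofReal_norm]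
  refine le_trans (le_of_eq ?_) hfg
  rw [Lp.enorm_def]
  refine eLpNorm_congr_ae ?_
  filter_upwards [Lp.coeFn_sub f (hm.toLp g), hm.coeFn_toLp] with t h1 h2
  rw [h1, Pi.sub_apply, Pi.sub_apply, h2]

/-- For `1 < p < ∞`, the coefficients of the regular representation on `L^p` vanish at infinity. -/
theorem tendsto_dual_translate_cocompact (hp : p ≠ ∞) (hp1 : 1 < p)
    (ℓ : StrongDual ℂ (Lp ℂ p m)) (f : Lp ℂ p m) :
    Tendsto (fun x => ℓ (translate m x f)) (cocompact G) (𝓝 0) := by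
  refine Metric.tendsto_nhds.2 fun ε hε => ?_
  obtain ⟨g, hm, hg, hc, hfg⟩ := exists_cc_norm_toLp_sub_le m hp f
    (ε := ε / (2 * (‖ℓ‖ + 1))) (by positivity)
  filter_upwards [Metric.tendsto_nhds.1
    (tendsto_dual_translate_cocompact_of_cc m hp hp1 hg hc hm ℓ) (ε / 2) (by positivity)] with x hx
  rw [dist_zero_right] at hx ⊢
  have h1 : translate m x f = translate m x (f - hm.toLp g) + translate m x (hm.toLp g) := by
    rw [← translate_add, sub_add_cancel]
  have h2 : ‖ℓ (translate m x (f - hm.toLp g))‖ ≤ ε / 2 := by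
    refine (norm_dual_translate_le m ℓ _ x).trans ?_
    calc _ ≤ (‖ℓ‖ + 1) * (ε / (2 * (‖ℓ‖ + 1))) := by gcongr; linarith
      _ = ε / 2 := by field_simp
  rw [h1, map_add]
  exact (norm_add_le _ _).trans_lt (by linarith)

/-- The coefficients of the regular representation on `L^p`, as elements of `C₀(G)`. -/
noncomputable def coeffZeroAtInfty (hp : p ≠ ∞) (hp1 : 1 < p) (ℓ : StrongDual ℂ (Lp ℂ p m))
    (f : Lp ℂ p m) : C₀(G, ℂ) :=
  ⟨⟨fun x => ℓ (translate m x f), continuous_dual_translate m hp ℓ f⟩,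
    tendsto_dual_translate_cocompact m hp hp1 ℓ f⟩

theorem dual_convOp_eq_cint_coeff (hp : p ≠ ∞) (hp1 : 1 < p) (μ : M G)
    (ℓ : StrongDual ℂ (Lp ℂ p m)) (f : Lp ℂ p m) :
    ℓ (convOp m hp μ f) = cint μ.1 (coeffZeroAtInfty m hp hp1 ℓ f) :=
  dual_convOp m hp μ ℓ f

/-- The coefficients of the regular representation on `L^p` approximate all functions in
`C_c(G)` uniformly. -/
theorem exists_dual_translate_approx (p : ℝ≥0∞) [Fact (1 ≤ p)] {g : G → ℂ}
    (hg : Continuous g) (hgc : HasCompactSupport g)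
    {ε : ℝ} (hε : 0 < ε) : ∃ (ℓ : StrongDual ℂ (Lp ℂ p m)) (f : Lp ℂ p m),
      ∀ x, ‖g x - ℓ (translate m x f)‖ ≤ ε := by
  obtain ⟨V, hVg, hV, h1V⟩ := eventually_nhds_iff.1 (unif_right hg hgc 1 hε)
  obtain ⟨φ, h1, h2, h3, h4⟩ := exists_continuousMap_one_of_isCompact_subset_isOpen
    (isCompact_singleton (x := (1 : G))) hV (by simpa using h1V)
  have h2' : HasCompactSupport φ := h2
  have hφ1 : φ 1 = 1 := h1 rfl
  have hφi : Integrable φ m := φ.continuous.integrable_of_hasCompactSupport h2'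
  set c := ∫ t, φ t ∂m with hc
  have hc0 : 0 < c := φ.continuous.integral_pos_of_hasCompactSupport_nonneg_nonzero h2'
    (fun x => (h4 x).1) (x := 1) (by rw [hφ1]; exact one_ne_zero)
  set f : G → ℂ := fun t => ((c⁻¹ * φ t : ℝ) : ℂ) with hfdef
  have hf : Continuous f := by fun_prop
  have hfc : HasCompactSupport f := h2'.comp_left (g := fun r : ℝ => ((c⁻¹ * r : ℝ) : ℂ)) (by simp)
  have hfm : MemLp f p m := hf.memLp_of_hasCompactSupport hfc
  have hf1 : ∫ t, f t ∂m = 1 := by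
    have h : ∫ t, f t ∂m = ((∫ t, c⁻¹ * φ t ∂m : ℝ) : ℂ) := integral_ofReal
    rw [h, integral_const_mul, ← hc, inv_mul_cancel₀ hc0.ne', Complex.ofReal_one]
  have hfn (t) : ‖f t‖ = c⁻¹ * φ t := by
    rw [hfdef, Complex.norm_real, Real.norm_of_nonneg (mul_nonneg (by positivity) (h4 t).1)]
  set q := ENNReal.conjExponent p with hq
  have hq1 : Fact (1 ≤ q) := ⟨by rw [hq, ENNReal.conjExponent]; exact le_self_add⟩
  have hgm : MemLp g q m := hg.memLp_of_hasCompactSupport hgc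
  refine ⟨((ContinuousLinearMap.mul ℂ ℂ).lpPairing m p q).flip (hgm.toLp g), hfm.toLp f,
    fun x => ?_⟩
  have e1 : ((ContinuousLinearMap.mul ℂ ℂ).lpPairing m p q).flip (hgm.toLp g)
      (translate m x (hfm.toLp f)) = ∫ t, f t * g (x * t) ∂m := by
    rw [ContinuousLinearMap.flip_apply, ContinuousLinearMap.lpPairing_eq_integral,
      ← integral_mul_left_eq_self (fun t => f t * g (x * t)) x⁻¹]
    refine integral_congr_ae ?_
    filter_upwards [translate_toLp_ae m hfm x, hgm.coeFn_toLp] with t ht1 ht2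
    rw [ht1, ht2, ContinuousLinearMap.mul_apply', mul_inv_cancel_left]
  have i1 : Integrable (fun t => f t * g x) m :=
    (hf.integrable_of_hasCompactSupport hfc).mul_const _
  have i2 : Integrable (fun t => f t * g (x * t)) m :=
    (hf.mul (hg.comp (continuous_const_mul x))).integrable_of_hasCompactSupport hfc.mul_right
  have e2 : g x = ∫ t, f t * g x ∂m := by rw [integral_mul_const, hf1, one_mul]
  rw [e1]
  nth_rewrite 1 [e2]
  rw [← integral_sub i1 i2]
  calc _ ≤ ∫ t, c⁻¹ * φ t * ε ∂m := by
        refine norm_integral_le_of_norm_le ((hφi.const_mul _).mul_const _)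
          (ae_of_all _ fun t => ?_)
        rw [← mul_sub, norm_mul, hfn]
        by_cases ht : t ∈ V
        · have := hVg t ht x
          rw [mul_one, norm_sub_rev] at this
          exact mul_le_mul_of_nonneg_left this.le (mul_nonneg (by positivity) (h4 t).1)
        · have : φ t = 0 := image_eq_zero_of_notMem_tsupport fun h => ht (h3 h)
          simp [this]
    _ = ε := by
        rw [integral_mul_const, integral_const_mul, ← hc, inv_mul_cancel₀ hc0.ne', one_mul]

end Coefficients

section MeanErgodicTheorem

variable {X : Type*} [NormedAddCommGroup X] [NormedSpace ℂ X]

theorem mul_opCesaro (T : X →L[ℂ] X) (n : ℕ) :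
    T * opCesaro T n = opCesaro T n + (n : ℂ)⁻¹ • (T ^ (n + 1) - T) := by
  have h : T * ∑ k ∈ Finset.range n, T ^ (k + 1) =
      ∑ k ∈ Finset.range n, T ^ (k + 1) + (T ^ (n + 1) - T) := by
    induction n with
    | zero => simp
    | succ n ih =>
      rw [Finset.sum_range_succ, mul_add, ih, ← pow_succ']
      abel
  rw [opCesaro, mul_smul_comm, h, smul_add]

theorem opCesaro_mul (T : X →L[ℂ] X) (n : ℕ) : opCesaro T n * T = T * opCesaro T n := by
  rw [opCesaro, mul_smul_comm, smul_mul_assoc, Finset.mul_sum, Finset.sum_mul]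
  simp_rw [← pow_succ, ← pow_succ']

theorem opCesaro_mul_eq_of_mul_eq {T P : X →L[ℂ] X} (h : T * P = P) {n : ℕ} (hn : n ≠ 0) :
    opCesaro T n * P = P := by
  have hk (k : ℕ) : T ^ (k + 1) * P = P := by
    induction k with
    | zero => simpa using h
    | succ k ih => rw [pow_succ, mul_assoc, h, ih]
  rw [opCesaro, smul_mul_assoc, Finset.sum_mul]
  simp_rw [hk]
  rw [Finset.sum_const, Finset.card_range, ← Nat.cast_smul_eq_nsmul ℂ, smul_smul,
    inv_mul_cancel₀ (by exact_mod_cast hn), one_smul]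

theorem mul_opCesaro_eq_of_mul_eq {T P : X →L[ℂ] X} (h : P * T = P) {n : ℕ} (hn : n ≠ 0) :
    P * opCesaro T n = P := by
  have hk (k : ℕ) : P * T ^ (k + 1) = P := by
    induction k with
    | zero => simpa using h
    | succ k ih => rw [pow_succ', ← mul_assoc, h, ih]
  rw [opCesaro, mul_smul_comm, Finset.mul_sum]
  simp_rw [hk]
  rw [Finset.sum_const, Finset.card_range, ← Nat.cast_smul_eq_nsmul ℂ, smul_smul,
    inv_mul_cancel₀ (by exact_mod_cast hn), one_smul]

theorem tendsto_inv_mul_dual_sub {T : X →L[ℂ] X}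
    (hT : ∀ (ℓ : StrongDual ℂ X) (f : X),
      Tendsto (fun n : ℕ => ((n : ℂ) + 1)⁻¹ * ℓ ((T ^ (n + 1)) f)) atTop (𝓝 0))
    (ℓ : StrongDual ℂ X) (f : X) :
    Tendsto (fun n : ℕ => ℓ (((n : ℂ)⁻¹ • (T ^ (n + 1) - T)) f)) atTop (𝓝 0) := by
  have h1 : Tendsto (fun n : ℕ => ((n : ℂ) / (n + 1))⁻¹) atTop (𝓝 1) := by
    simpa using tendsto_natCast_div_add_one.inv₀ one_ne_zero
  have h2 : Tendsto (fun n : ℕ => (n : ℂ)⁻¹ * ℓ (T f)) atTop (𝓝 (0 * ℓ (T f))) :=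
    (tendsto_inv_atTop_nhds_zero_nat (𝕜 := ℂ)).mul_const _
  have h3 := (h1.mul (hT ℓ f)).sub h2
  rw [one_mul, zero_mul, sub_zero] at h3
  refine h3.congr fun n => ?_
  have h : (n : ℂ) + 1 ≠ 0 := by exact_mod_cast n.succ_ne_zero
  rw [_root_.smul_apply, _root_.sub_apply, map_smul, map_sub, smul_eq_mul, inv_div, mul_sub,
    ← mul_assoc, div_mul_eq_mul_div, mul_inv_cancel₀ h, one_div]

theorem tendsto_dual_mul_opCesaro {T P : X →L[ℂ] X} {l : Filter ℕ} (hl : l ≤ atTop)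
    (hT : ∀ (ℓ : StrongDual ℂ X) (f : X),
      Tendsto (fun n : ℕ => ((n : ℂ) + 1)⁻¹ * ℓ ((T ^ (n + 1)) f)) atTop (𝓝 0))
    (hP : ∀ (ℓ : StrongDual ℂ X) (f : X), Tendsto (fun n => ℓ (opCesaro T n f)) l (𝓝 (ℓ (P f))))
    (ℓ : StrongDual ℂ X) (f : X) :
    Tendsto (fun n => ℓ ((T * opCesaro T n) f)) l (𝓝 (ℓ (P f))) := by
  have h := (hP ℓ f).add ((tendsto_inv_mul_dual_sub hT ℓ f).mono_left hl)
  rw [add_zero] at h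
  refine h.congr fun n => ?_
  rw [mul_opCesaro, _root_.add_apply, map_add]

theorem mul_eq_of_tendsto_opCesaro {T P : X →L[ℂ] X} {l : Filter ℕ} [NeBot l] (hl : l ≤ atTop)
    (hT : ∀ (ℓ : StrongDual ℂ X) (f : X),
      Tendsto (fun n : ℕ => ((n : ℂ) + 1)⁻¹ * ℓ ((T ^ (n + 1)) f)) atTop (𝓝 0))
    (hP : ∀ (ℓ : StrongDual ℂ X) (f : X), Tendsto (fun n => ℓ (opCesaro T n f)) l (𝓝 (ℓ (P f)))) :
    T * P = P := by
  ext1 f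
  refine (SeparatingDual.eq_iff_forall_dual_eq (R := ℂ)).2 fun ℓ => ?_
  exact tendsto_nhds_unique (hP (ℓ.comp T) f) (tendsto_dual_mul_opCesaro hl hT hP ℓ f)

theorem eq_mul_of_tendsto_opCesaro {T P : X →L[ℂ] X} {l : Filter ℕ} [NeBot l] (hl : l ≤ atTop)
    (hT : ∀ (ℓ : StrongDual ℂ X) (f : X),
      Tendsto (fun n : ℕ => ((n : ℂ) + 1)⁻¹ * ℓ ((T ^ (n + 1)) f)) atTop (𝓝 0))
    (hP : ∀ (ℓ : StrongDual ℂ X) (f : X), Tendsto (fun n => ℓ (opCesaro T n f)) l (𝓝 (ℓ (P f)))) :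
    P * T = P := by
  ext1 f
  refine (SeparatingDual.eq_iff_forall_dual_eq (R := ℂ)).2 fun ℓ => ?_
  refine tendsto_nhds_unique (hP ℓ (T f)) ?_
  refine (tendsto_dual_mul_opCesaro hl hT hP ℓ f).congr fun n => ?_
  rw [← opCesaro_mul]
  rfl

/-- Uniqueness in the mean ergodic theorem: the Cesàro means have at most one weak cluster point. -/
theorem eq_of_tendsto_opCesaro {T P Q : X →L[ℂ] X} {l l' : Filter ℕ} [NeBot l] [NeBot l']
    (hl : l ≤ atTop) (hl' : l' ≤ atTop)
    (hT : ∀ (ℓ : StrongDual ℂ X) (f : X),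
      Tendsto (fun n : ℕ => ((n : ℂ) + 1)⁻¹ * ℓ ((T ^ (n + 1)) f)) atTop (𝓝 0))
    (hP : ∀ (ℓ : StrongDual ℂ X) (f : X), Tendsto (fun n => ℓ (opCesaro T n f)) l (𝓝 (ℓ (P f))))
    (hQ : ∀ (ℓ : StrongDual ℂ X) (f : X),
      Tendsto (fun n => ℓ (opCesaro T n f)) l' (𝓝 (ℓ (Q f)))) : P = Q := by
  have h1 := mul_eq_of_tendsto_opCesaro hl hT hP
  have h2 := eq_mul_of_tendsto_opCesaro hl' hT hQ
  have e1 : Q * P = P := by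
    ext1 f
    refine (SeparatingDual.eq_iff_forall_dual_eq (R := ℂ)).2 fun ℓ => ?_
    refine tendsto_nhds_unique (hQ ℓ (P f)) (tendsto_const_nhds.congr' ?_)
    filter_upwards [hl' (eventually_ne_atTop 0)] with n hn
    exact congrArg (fun S : X →L[ℂ] X => ℓ (S f)) (opCesaro_mul_eq_of_mul_eq h1 hn).symm
  have e2 : Q * P = Q := by
    ext1 f
    refine (SeparatingDual.eq_iff_forall_dual_eq (R := ℂ)).2 fun ℓ => ?_
    refine tendsto_nhds_unique (hP (ℓ.comp Q) f) (tendsto_const_nhds.congr' ?_)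
    filter_upwards [hl (eventually_ne_atTop 0)] with n hn
    exact congrArg (fun S : X →L[ℂ] X => ℓ (S f)) (mul_opCesaro_eq_of_mul_eq h2 hn).symm
  rw [← e1, e2]

theorem MeanErgodic.weaklyMeanErgodic {T : X →L[ℂ] X} (h : MeanErgodic T) :
    WeaklyMeanErgodic T := by
  obtain ⟨P, hP⟩ := h
  refine ⟨P, ContinuousLinearMapWOT.tendsto_iff_forall_dual_apply_tendsto.2 fun f ℓ => ?_⟩
  exact (ℓ.continuous.tendsto _).comp (hP f)

end MeanErgodicTheorem

section Main

set_option linter.unusedSectionVars false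

variable {G : Type*} [Group G] [TopologicalSpace G] [IsTopologicalGroup G] [LocallyCompactSpace G]
  [T2Space G] [MeasurableSpace G] [BorelSpace G]
  (m : Measure G) [m.IsHaarMeasure] [m.Regular] {p : ℝ≥0∞} [Fact (1 ≤ p)]

theorem IsVagueErgodic.cesaroBounded {μ : M G} (h : IsVagueErgodic μ) : CesaroBounded μ :=
  exists_variation_le_of_vagueTendsto h.choose_spec

theorem IsVagueErgodic.weaklyMeanErgodic (hp : p ≠ ∞) (hp1 : 1 < p) {μ : M G}
    (h : IsVagueErgodic μ) : WeaklyMeanErgodic (convOp m hp μ) := by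
  obtain ⟨κ, hκ⟩ := h
  refine ⟨convOp m hp κ, ContinuousLinearMapWOT.tendsto_iff_forall_dual_apply_tendsto.2
    fun f ℓ => ?_⟩
  simp only [ContinuousLinearMapWOT.ofCLM_apply, opCesaro_convOp,
    dual_convOp_eq_cint_coeff m hp hp1]
  exact hκ _

theorem vagueTendsto_of_weaklyMeanErgodic (hp : p ≠ ∞) {μ : M G} (hμ : CesaroBounded μ)
    (h : WeaklyMeanErgodic (convOp m hp μ)) :
    VagueTendsto (fun n => ((n : ℂ) + 1)⁻¹ • convPowSucc μ n) 0 := by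
  obtain ⟨C, hC⟩ := hμ.exists_variation_inv_smul_le
  obtain ⟨P, hP⟩ := h
  have hP' (f : Lp ℂ p m) (ℓ : StrongDual ℂ (Lp ℂ p m)) :
      Tendsto (fun n => ℓ (convOp m hp (cesaro μ n) f)) atTop (𝓝 (ℓ (P f))) := by
    have := ContinuousLinearMapWOT.tendsto_iff_forall_dual_apply_tendsto.1 hP f ℓ
    simpa only [ContinuousLinearMapWOT.ofCLM_apply, opCesaro_convOp] using this
  refine tendsto_cint_of_forall_cc hC fun g hg hgc =>
    tendsto_cint_of_forall_approx hC (fun κ => integrable_hasCompactSupport κ hg hgc) fun ε hε => ?_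
  obtain ⟨ℓ, f, hf⟩ := exists_dual_translate_approx m p hg hgc hε
  refine ⟨fun x => ℓ (translate m x f), fun κ => integrable_dual_translate m hp κ ℓ f, hf, ?_⟩
  have h0 : cint (0 : M G).1 (fun x => ℓ (translate m x f)) = 0 :=
    VectorMeasure.integral_zero_vectorMeasure
  rw [h0]
  have h1 := ((hP' f ℓ).comp (tendsto_add_atTop_nat 1)).sub
    (tendsto_natCast_div_add_one.mul (hP' f ℓ))
  rw [one_mul, sub_self] at h1
  refine h1.congr fun n => ?_
  rw [← dual_convOp m hp, inv_smul_convPowSucc, convOp_sub, convOp_smul, _root_.sub_apply,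
    _root_.smul_apply, map_sub, map_smul]
  rfl

theorem cint_eq_of_convOp_eq (hp : p ≠ ∞) {κ κ' : M G} (h : convOp m hp κ = convOp m hp κ')
    (φ : C₀(G, ℂ)) : cint κ.1 φ = cint κ'.1 φ := by
  have hC : ∀ _n : ℕ, κ.1.variation Set.univ ≤ (κ.1.variation Set.univ).toNNReal := fun _ =>
    (ENNReal.coe_toNNReal (measure_ne_top _ _)).ge
  have key : Tendsto (fun _ : ℕ => cint κ.1 φ) atTop (𝓝 (cint κ'.1 φ)) := by
    refine tendsto_cint_of_forall_cc hC (fun g hg hgc =>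
      tendsto_cint_of_forall_approx hC (fun κ => integrable_hasCompactSupport κ hg hgc)
        fun ε hε => ?_) φ
    obtain ⟨ℓ, f, hf⟩ := exists_dual_translate_approx m p hg hgc hε
    refine ⟨fun x => ℓ (translate m x f), fun κ => integrable_dual_translate m hp κ ℓ f, hf, ?_⟩
    rw [← dual_convOp m hp, ← dual_convOp m hp, h]
    exact tendsto_const_nhds
  exact tendsto_nhds_unique tendsto_const_nhds key

theorem isVagueErgodic_of_vagueTendsto {μ : M G} (hμ : CesaroBounded μ)
    (h : VagueTendsto (fun n => ((n : ℂ) + 1)⁻¹ • convPowSucc μ n) 0) : IsVagueErgodic μ := by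
  obtain ⟨C, hC⟩ := hμ
  let m : Measure G := Measure.haar
  have h2 : (2 : ℝ≥0∞) ≠ ∞ := ENNReal.ofNat_ne_top
  have h12 : (1 : ℝ≥0∞) < 2 := ENNReal.one_lt_two
  choose κ hκ using fun 𝒰 : Ultrafilter ℕ => exists_tendsto_cint_ultrafilter 𝒰 hC
  have hT (ℓ : StrongDual ℂ (Lp ℂ 2 m)) (f : Lp ℂ 2 m) :
      Tendsto (fun n : ℕ => ((n : ℂ) + 1)⁻¹ * ℓ ((convOp m h2 μ ^ (n + 1)) f)) atTop (𝓝 0) := by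
    have h3 := h (coeffZeroAtInfty m h2 h12 ℓ f)
    have h0 : cint (0 : M G).1 (coeffZeroAtInfty m h2 h12 ℓ f) = 0 :=
      VectorMeasure.integral_zero_vectorMeasure
    rw [h0] at h3
    refine h3.congr fun n => ?_
    rw [← dual_convOp_eq_cint_coeff, convOp_smul, convOp_convPowSucc, _root_.smul_apply, map_smul,
      smul_eq_mul]
  have hκT (𝒰 : Ultrafilter ℕ) (ℓ : StrongDual ℂ (Lp ℂ 2 m)) (f : Lp ℂ 2 m) :
      Tendsto (fun n => ℓ (opCesaro (convOp m h2 μ) n f)) 𝒰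
        (𝓝 (ℓ (convOp m h2 (κ 𝒰) f))) := by
    simp only [opCesaro_convOp, dual_convOp_eq_cint_coeff m h2 h12]
    exact hκ 𝒰 _
  let 𝒱 : Ultrafilter ℕ := Ultrafilter.of atTop
  have h𝒱 : (𝒱 : Filter ℕ) ≤ atTop := Ultrafilter.of_le _
  refine ⟨κ 𝒱, fun φ => (tendsto_iff_ultrafilter _ _ _).2 fun 𝒰 h𝒰 => ?_⟩
  rw [cint_eq_of_convOp_eq m h2 (eq_of_tendsto_opCesaro h𝒱 h𝒰 hT (hκT 𝒱) (hκT 𝒰)) φ]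
  exact hκ 𝒰 φ

theorem variation_supportSubgroup_compl (μ : M G) :
    μ.1.variation (supportSubgroup μ : Set G)ᶜ = 0 := by
  refine measure_mono_null (Set.compl_subset_compl.2 ?_)
    (Measure.measure_compl_support_of_regular (μ := μ.1.variation))
  exact Subgroup.subset_closure.trans (Subgroup.le_topologicalClosure _)

theorem variation_conv_compl {H : Subgroup G} (hH : IsClosed (H : Set G)) {μ ν : M G}
    (hμ : μ.1.variation (H : Set G)ᶜ = 0) (hν : ν.1.variation (H : Set G)ᶜ = 0) :
    (conv μ ν).1.variation (H : Set G)ᶜ = 0 := by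
  have h := variation_le_of_forall_norm_cint_le (conv μ ν) hH.isOpen_compl (C := 0)
    fun f hf hc hfH _ => ?_
  · simpa using h
  have hf0 {x : G} (hx : x ∈ H) : f x = 0 :=
    image_eq_zero_of_notMem_tsupport fun h => hfH h hx
  have hμ' : ∀ᵐ x ∂μ.1.variation, x ∈ H := mem_ae_iff.2 hμ
  have hν' : ∀ᵐ x ∂ν.1.variation, x ∈ H := mem_ae_iff.2 hν
  rw [cint_conv μ ν hf hc, cint, VectorMeasure.integral_eq_zero_of_ae, norm_zero]
  filter_upwards [hν'] with y hy
  refine VectorMeasure.integral_eq_zero_of_ae ?_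
  filter_upwards [hμ'] with x hx
  exact hf0 (mul_mem hx hy)

theorem variation_cesaro_compl (μ : M G) (n : ℕ) :
    (cesaro μ n).1.variation (supportSubgroup μ : Set G)ᶜ = 0 := by
  have h (k : ℕ) : (convPowSucc μ k).1.variation (supportSubgroup μ : Set G)ᶜ = 0 := by
    induction k with
    | zero => exact variation_supportSubgroup_compl μ
    | succ k ih =>
      exact variation_conv_compl (Subgroup.isClosed_topologicalClosure _) ih
        (variation_supportSubgroup_compl μ)
  have e : (cesaro μ n).1 = (n : ℂ)⁻¹ • ∑ k ∈ Finset.range n, (convPowSucc μ k).1 := by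
    simp [cesaro]
  have hs : (∑ k ∈ Finset.range n, (convPowSucc μ k).1).variation
      (supportSubgroup μ : Set G)ᶜ = 0 := by
    refine le_antisymm ((VectorMeasure.variation_finsetSum_le _ _ _).trans_eq ?_) zero_le
    rw [Measure.finsetSum_apply]
    exact Finset.sum_eq_zero fun k _ => h k
  rw [e, VectorMeasure.variation_smul, Measure.smul_apply, hs, smul_zero]

theorem variation_compl_of_vagueTendsto {ν : ℕ → M G} {κ : M G} (h : VagueTendsto ν κ)
    {H : Set G} (hH : IsClosed H) (hν : ∀ n, (ν n).1.variation Hᶜ = 0) :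
    κ.1.variation Hᶜ = 0 := by
  have h := variation_le_of_forall_norm_cint_le κ hH.isOpen_compl (C := 0)
    fun f hf hc hfH _ => ?_
  · simpa using h
  let φ : C₀(G, ℂ) := ⟨⟨f, hf⟩, hc.is_zero_at_infty⟩
  have h0 (n : ℕ) : cint (ν n).1 φ = 0 := by
    refine VectorMeasure.integral_eq_zero_of_ae ?_
    have hν' : ∀ᵐ x ∂(ν n).1.variation, x ∈ H := mem_ae_iff.2 (hν n)
    filter_upwards [hν'] with x hx
    exact image_eq_zero_of_notMem_tsupport (f := f) fun h => hfH h hx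
  have h1 : cint κ.1 φ = 0 := by
    refine tendsto_nhds_unique (h φ) ?_
    simp_rw [h0]
    exact tendsto_const_nhds
  exact (norm_eq_zero.2 h1).le

/-- On a compact set, an orbit of the regular representation is uniformly close to a function of
finite rank. -/
theorem exists_translate_approx (hp : p ≠ ∞) {H : Set G} (hH : IsCompact H) (f : Lp ℂ p m) {ε : ℝ}
    (hε : 0 < ε) : ∃ (N : ℕ) (φ : Fin N → G → ℂ) (v : Fin N → Lp ℂ p m),
      (∀ i, Continuous (φ i) ∧ HasCompactSupport (φ i)) ∧
      ∀ x ∈ H, ‖translate m x f - ∑ i, φ i x • v i‖ ≤ ε := by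
  have hc := continuous_translate m hp f
  obtain ⟨t, ht⟩ := hH.elim_finite_subcover
    (fun y : G => {x | ‖translate m x f - translate m y f‖ < ε})
    (fun y => isOpen_lt (hc.sub continuous_const).norm continuous_const)
    (fun x _ => Set.mem_iUnion.2 ⟨x, by simpa using hε⟩)
  let y (i : Fin t.card) : G := t.equivFin.symm i
  obtain ⟨φ, h1, h2, h3, h4⟩ := exists_continuous_sum_one_of_isOpen_isCompact
    (s := fun i => {x | ‖translate m x f - translate m (y i) f‖ < ε})
    (fun i => isOpen_lt (hc.sub continuous_const).norm continuous_const) hH (fun x hx => by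
      obtain ⟨z, hz, hxz⟩ := Set.mem_iUnion₂.1 (ht hx)
      refine Set.mem_iUnion.2 ⟨t.equivFin ⟨z, hz⟩, ?_⟩
      simpa [y] using hxz)
  refine ⟨t.card, fun i x => (φ i x : ℂ), fun i => translate m (y i) f, fun i =>
    ⟨by fun_prop, (h4 i).comp_left (g := Complex.ofReal) Complex.ofReal_zero⟩, fun x hx => ?_⟩
  have hsum : ∑ i, φ i x = 1 := by simpa using h2 hx
  have e : translate m x f - ∑ i, (φ i x : ℂ) • translate m (y i) f =
      ∑ i, (φ i x : ℂ) • (translate m x f - translate m (y i) f) := by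
    simp_rw [smul_sub]
    rw [Finset.sum_sub_distrib, ← Finset.sum_smul, ← Complex.ofReal_sum, hsum, Complex.ofReal_one,
      one_smul]
  rw [e]
  calc _ ≤ ∑ i, φ i x * ε := by
        refine norm_sum_le_of_le _ fun i _ => ?_
        rw [norm_smul, Complex.norm_real, Real.norm_of_nonneg (h3 i x).1]
        by_cases hi : x ∈ tsupport (φ i)
        · have hxi : ‖translate m x f - translate m (y i) f‖ < ε := h1 i hi
          exact mul_le_mul_of_nonneg_left hxi.le (h3 i x).1
        · rw [image_eq_zero_of_notMem_tsupport hi, zero_mul, zero_mul]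
    _ = ε := by rw [← Finset.sum_mul, hsum, one_mul]

theorem norm_convOp_sub_sum_le (hp : p ≠ ∞) {H : Set G} {κ : M G} {C : ℝ≥0}
    (hC : κ.1.variation Set.univ ≤ C) (hκ : κ.1.variation Hᶜ = 0) (f : Lp ℂ p m) {ε : ℝ} {N : ℕ}
    {φ : Fin N → G → ℂ} {v : Fin N → Lp ℂ p m}
    (hφ : ∀ i, Continuous (φ i) ∧ HasCompactSupport (φ i)) (hε : 0 ≤ ε)
    (hf : ∀ x ∈ H, ‖translate m x f - ∑ i, φ i x • v i‖ ≤ ε) :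
    ‖convOp m hp κ f - ∑ i, cint κ.1 (φ i) • v i‖ ≤ ε * C := by
  refine NormedSpace.norm_le_dual_bound ℂ _ (by positivity) fun ℓ => ?_
  have hi (i) : κ.1.Integrable (φ i) := integrable_hasCompactSupport κ (hφ i).1 (hφ i).2
  have hi' (i) : κ.1.Integrable fun x => ℓ (v i) * φ i x :=
    MeasureTheory.Integrable.const_mul (hi i) _
  have e : ℓ (convOp m hp κ f - ∑ i, cint κ.1 (φ i) • v i) =
      cint κ.1 fun x => ℓ (translate m x f) - ∑ i, ℓ (v i) * φ i x := by
    rw [cint_sub κ.1 (integrable_dual_translate m hp κ ℓ f) (integrable_finsetSum _ fun i _ => hi' i),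
      map_sub, dual_convOp, map_sum]
    congr 1
    rw [cint, VectorMeasure.integral_finsetSum _ fun i _ => hi' i]
    refine Finset.sum_congr rfl fun i _ => ?_
    rw [map_smul, smul_eq_mul, mul_comm]
    exact (cint_const_mul κ (hi i) _).symm
  rw [e]
  have hH : ∀ᵐ x ∂κ.1.variation, x ∈ H := mem_ae_iff.2 hκ
  refine (norm_cint_le κ.1 (C := ‖ℓ‖ * ε) ?_).trans ?_
  · filter_upwards [hH] with x hx
    have : ℓ (translate m x f) - ∑ i, ℓ (v i) * φ i x =
        ℓ (translate m x f - ∑ i, φ i x • v i) := by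
      rw [map_sub, map_sum]
      simp only [map_smul, smul_eq_mul, mul_comm]
    rw [this]
    exact (ℓ.le_opNorm _).trans (mul_le_mul_of_nonneg_left (hf x hx) (norm_nonneg _))
  · have : κ.1.variation.real Set.univ ≤ C := ENNReal.toReal_mono ENNReal.coe_ne_top hC
    calc _ ≤ ‖ℓ‖ * ε * C := by gcongr
      _ = _ := by ring

theorem IsVagueErgodic.meanErgodic (hp : p ≠ ∞) {μ : M G} (h : IsVagueErgodic μ)
    (hH : IsCompact (supportSubgroup μ : Set G)) : MeanErgodic (convOp m hp μ) := by
  obtain ⟨C, hC⟩ := h.cesaroBounded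
  obtain ⟨κ, hκ⟩ := h
  refine ⟨convOp m hp κ, fun f => Metric.tendsto_nhds.2 fun ε hε => ?_⟩
  set D : ℝ≥0 := (κ.1.variation Set.univ).toNNReal with hD
  have hκD : κ.1.variation Set.univ ≤ D := (ENNReal.coe_toNNReal (measure_ne_top _ _)).ge
  have hκH := variation_compl_of_vagueTendsto hκ (Subgroup.isClosed_topologicalClosure _)
    (variation_cesaro_compl μ)
  set δ : ℝ := ε / (2 * (C + D + 1)) with hδ
  have hδ0 : 0 < δ := by positivity
  obtain ⟨N, φ, v, hφ, hf⟩ := exists_translate_approx m hp hH f hδ0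
  have hlim : Tendsto (fun n => ∑ i, cint (cesaro μ n).1 (φ i) • v i) atTop
      (𝓝 (∑ i, cint κ.1 (φ i) • v i)) := by
    refine tendsto_finsetSum _ fun i _ => Tendsto.smul_const ?_ _
    exact hκ ⟨⟨φ i, (hφ i).1⟩, (hφ i).2.is_zero_at_infty⟩
  filter_upwards [Metric.tendsto_nhds.1 hlim (ε / 2) (by positivity)] with n hn
  have h1 := norm_convOp_sub_sum_le m hp (hC n) (variation_cesaro_compl μ n) f hφ hδ0.le hf
  have h2 := norm_convOp_sub_sum_le m hp hκD hκH f hφ hδ0.le hf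
  rw [opCesaro_convOp, dist_eq_norm]
  rw [dist_eq_norm] at hn
  have e : convOp m hp (cesaro μ n) f - convOp m hp κ f =
      (convOp m hp (cesaro μ n) f - ∑ i, cint (cesaro μ n).1 (φ i) • v i) +
      (∑ i, cint (cesaro μ n).1 (φ i) • v i - ∑ i, cint κ.1 (φ i) • v i) -
      (convOp m hp κ f - ∑ i, cint κ.1 (φ i) • v i) := by abel
  have h3 : δ * C + δ * D + δ = ε / 2 := by
    rw [← mul_add, ← mul_add_one, hδ]
    field_simp
  rw [e]
  refine (norm_sub_le _ _).trans_lt ?_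
  have := norm_add_le (convOp m hp (cesaro μ n) f - ∑ i, cint (cesaro μ n).1 (φ i) • v i)
    (∑ i, cint (cesaro μ n).1 (φ i) • v i - ∑ i, cint κ.1 (φ i) • v i)
  linarith

end Main
end VagueErgodic

theorem proposition3p3 {G : Type*} [Group G] [TopologicalSpace G] [IsTopologicalGroup G]
    [LocallyCompactSpace G] [T2Space G] [MeasurableSpace G] [BorelSpace G]
    (m : Measure G) [m.IsHaarMeasure] [m.Regular] (μ : VagueErgodic.M G) :
    List.TFAE [
      VagueErgodic.IsVagueErgodic μ,
      VagueErgodic.CesaroBounded μ ∧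
        VagueErgodic.VagueTendsto (fun n => ((n : ℂ) + 1)⁻¹ • VagueErgodic.convPowSucc μ n) 0,
      VagueErgodic.CesaroBounded μ ∧
        ∀ (p : ℝ≥0∞) (_ : Fact (1 ≤ p)) (hp : p ≠ ∞), 1 < p →
          VagueErgodic.WeaklyMeanErgodic (VagueErgodic.convOp m hp μ),
      VagueErgodic.CesaroBounded μ ∧
        ∃ (p : ℝ≥0∞) (_ : Fact (1 ≤ p)) (hp : p ≠ ∞), 1 < p ∧
          VagueErgodic.WeaklyMeanErgodic (VagueErgodic.convOp m hp μ)] ∧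
    (IsCompact (VagueErgodic.supportSubgroup μ : Set G) →
      List.TFAE [
        VagueErgodic.IsVagueErgodic μ,
        VagueErgodic.CesaroBounded μ ∧
          VagueErgodic.VagueTendsto (fun n => ((n : ℂ) + 1)⁻¹ • VagueErgodic.convPowSucc μ n) 0,
        VagueErgodic.CesaroBounded μ ∧
          ∀ (p : ℝ≥0∞) (_ : Fact (1 ≤ p)) (hp : p ≠ ∞),
            VagueErgodic.MeanErgodic (VagueErgodic.convOp m hp μ),
        VagueErgodic.CesaroBounded μ ∧
          ∃ (p : ℝ≥0∞) (_ : Fact (1 ≤ p)) (hp : p ≠ ∞),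
            VagueErgodic.MeanErgodic (VagueErgodic.convOp m hp μ)]) := by
  constructor
  · tfae_have 1 → 3 := fun h => ⟨h.cesaroBounded, fun p _ hp hp1 => h.weaklyMeanErgodic m hp hp1⟩
    tfae_have 3 → 4 := fun h =>
      ⟨h.1, 2, inferInstance, ENNReal.ofNat_ne_top, ENNReal.one_lt_two,
        h.2 2 inferInstance ENNReal.ofNat_ne_top ENNReal.one_lt_two⟩
    tfae_have 4 → 2 := fun ⟨hb, p, _, hp, _, h⟩ =>
      ⟨hb, VagueErgodic.vagueTendsto_of_weaklyMeanErgodic m hp hb h⟩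
    tfae_have 2 → 1 := fun h => VagueErgodic.isVagueErgodic_of_vagueTendsto h.1 h.2
    tfae_finish
  · intro hH
    tfae_have 1 → 3 := fun h => ⟨h.cesaroBounded, fun p _ hp => h.meanErgodic m hp hH⟩
    tfae_have 3 → 4 := fun h =>
      ⟨h.1, 1, inferInstance, ENNReal.one_ne_top, h.2 1 inferInstance ENNReal.one_ne_top⟩
    tfae_have 4 → 2 := fun ⟨hb, p, _, hp, h⟩ =>
      ⟨hb, VagueErgodic.vagueTendsto_of_weaklyMeanErgodic m hp hb h.weaklyMeanErgodic⟩
    tfae_have 2 → 1 := fun h => VagueErgodic.isVagueErgodic_of_vagueTendsto h.1 h.2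
    tfae_finish
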